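/- Let $G$ be a finite group. For a subgroup $R\le G$ and an isomorphism $\alpha\colon S\to R$ between subgroups of $G$, put $\Delta(R,\alpha,S)=\{(\alpha(h),h)\mid h\in S\}\le G\times G$ and $\Delta(R)=\Delta(R,\mathrm{id}_R,R)$. Let $B(G)$ be the Burnside ring of $G$, i.e. the Grothendieck ring of finite left $G$-sets with respect to disjoint unions and direct products, with unit group $B(G)^\times$. Let $B^\Delta(G,G)$ be the Grothendieck ring of finite bifree $(G,G)$-bisets (left action of $G$ free, right action of $G$ free), with respect to disjoint unions and the tensor product $X\times_G Y$, the set of orbits of $G$ on $X\times Y$ under $h\cdot(x,y)=(xh^{-1},hy)$. Its identity is $[G]$; $(G,G)$-bisets are identified with left $(G\times G)$-sets by $(g,h)\cdot x=gxh^{-1}$, and the classes $[(G\times G)/\Delta(R,\alpha,S)]$ span $B^\Delta(G,G)$ over $\mathbb{Z}$. For a biset $X$ let $X^\circ$ be the set $X$ with the actions $hxg:=g^{-1}xh^{-1}$; this induces an anti-involution $\gamma\mapsto\gamma^\circ$ of $B^\Delta(G,G)$. Let $$B^\Delta_\circ(G,G)=\{\gamma\in B^\Delta(G,G)\mid \gamma\gamma^\circ=[G]=\gamma^\circ\gamma\}$$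 be the group of orthogonal units. Let $\iota\colon B(G)\to B^\Delta(G,G)$ be the ring homomorphism with $[G/R]\mapsto[(G\times G)/\Delta(R)]$ for $R\le G$. Let $\mathrm{Out}(G)=\mathrm{Aut}(G)/\mathrm{Inn}(G)$, let $\overline\phi$ denote the class of $\phi\in\mathrm{Aut}(G)$, and let $\mathrm{Out}(G)$ act on $B(G)$ by ring automorphisms with ${}^{\overline\phi}[G/R]=[G/\phi(R)]$. Let $\eta\colon\mathbb{Z}\mathrm{Out}(G)\to B^\Delta(G,G)$ be the ring homomorphism with $\overline\phi\mapsto[(G\times G)/\Delta(G,\phi,G)]$, and let $\rho\colon B^\Delta(G,G)\to\mathbb{Z}\mathrm{Out}(G)$ be the additive map with $[(G\times G)/\Delta(R,\alpha,S)]\mapsto\overline\alpha$ if $R=S=G$, and $\mapsto 0$ otherwise. Then the following hold. (a) $\iota(B(G)^\times)=\iota(B(G))\cap B^\Delta_\circ(G,G)$, and $\iota(B(G)^\times)$ is a normal subgroup of $B^\Delta_\circ(G,G)$. (b) $\eta$ restricts to an injective group homomorphism $\eta\colon\mathrm{Out}(G)\to B^\Delta_\circ(G,G)$. (c) For each $\gamma\in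 B^\Delta_\circ(G,G)$ there are a unique $\overline\phi\in\mathrm{Out}(G)$ and a unique $\epsilon\in\{\pm1\}$ with $\rho(\gamma)=\epsilon\cdot\overline\phi$. The resulting map $\pi\colon B^\Delta_\circ(G,G)\to\mathrm{Out}(G)$, $\gamma\mapsto\overline\phi$, is a surjective group homomorphism with $\pi\circ\eta=\mathrm{id}_{\mathrm{Out}(G)}$. (d) Let $\Lambda_G=\ker(\pi)\trianglelefteq B^\Delta_\circ(G,G)$ and $\Delta_G=\eta(\mathrm{Out}(G))\le B^\Delta_\circ(G,G)$. Then $\iota(B(G)^\times)\le\Lambda_G$, and $B^\Delta_\circ(G,G)=\Lambda_G\rtimes\Delta_G$ is an (internal) semidirect product. (e) For all $\overline\phi\in\mathrm{Out}(G)$ and $u\in B(G)^\times$ one has $\eta(\overline\phi)\,\iota(u)\,\eta(\overline\phi)^{-1}=\iota({}^{\overline\phi}u)$. -/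

import Mathlib

universe u v

noncomputable section

namespace BurnsideUnits

/-! ## The Grothendieck ring of a semiring -/

/-- The Grothendieck ring of a semiring `S`: the Grothendieck group of the additive monoid of `S`,
with the multiplication that extends the one of `S` biadditively. -/
def GrothendieckRing (S : Type v) [Semiring S] : Type v := Algebra.GrothendieckAddGroup S

namespace GrothendieckRing

variable {S : Type v} [Semiring S]

instance : AddCommGroup (GrothendieckRing S) :=
  inferInstanceAs (AddCommGroup (Algebra.GrothendieckAddGroup S))

/-- The canonical additive map from `S` to its Grothendieck ring. -/
def ofAdd : S →+ GrothendieckRing S := Algebra.GrothendieckAddGroup.of (M := S)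

/-- Additive maps to an abelian group extend to the Grothendieck ring. -/
def liftAdd {A : Type*} [AddCommGroup A] (f : S →+ A) : GrothendieckRing S →+ A :=
  Algebra.GrothendieckAddGroup.lift f

theorem liftAdd_of {A : Type*} [AddCommGroup A] (f : S →+ A) (s : S) :
    liftAdd f (ofAdd s) = f s :=
  DFunLike.congr_fun (Algebra.GrothendieckAddGroup.lift.symm_apply_apply f) s

theorem ind {p : GrothendieckRing S → Prop} (h1 : ∀ s, p (ofAdd s))
    (h2 : ∀ x y, p x → p y → p (x - y)) (x : GrothendieckRing S) : p x := by
  refine AddLocalization.induction_on (p := p) x ?_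
  rintro ⟨a, b, hb⟩
  have := h2 _ _ (h1 a) (h1 b)
  rw [show (ofAdd a - ofAdd b : GrothendieckRing S) = AddLocalization.mk a ⟨b, hb⟩ from ?_] at this
  · exact this
  symm
  refine Eq.trans ?_ (Algebra.GrothendieckAddGroup.mk_sub_mk a b 0 0).symm
  congr 1
  · simp
  · ext; simp

theorem addHom_ext {A : Type*} [AddCommGroup A] {f g : GrothendieckRing S →+ A}
    (h : ∀ s, f (ofAdd s) = g (ofAdd s)) : f = g := by
  ext x
  refine ind (p := fun x => f x = g x) h (fun x y hx hy => ?_) x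
  rw [map_sub, map_sub, hx, hy]

/-- The multiplication of the Grothendieck ring as a biadditive map. -/
def mulHom : GrothendieckRing S →+ GrothendieckRing S →+ GrothendieckRing S :=
  liftAdd
    { toFun := fun s => liftAdd (ofAdd.comp (AddMonoidHom.mulLeft s))
      map_zero' := addHom_ext fun t => by simp [liftAdd_of]
      map_add' := fun s s' => addHom_ext fun t => by simp [liftAdd_of, add_mul] }

instance : Mul (GrothendieckRing S) := ⟨fun x y => mulHom x y⟩

instance : One (GrothendieckRing S) := ⟨ofAdd 1⟩

theorem ofAdd_mul (s t : S) :
    (ofAdd (s * t) : GrothendieckRing S) = ofAdd s * ofAdd t := by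
  change _ = mulHom (ofAdd s) (ofAdd t)
  simp [mulHom, liftAdd_of]

theorem sub_mul_aux (x y z : GrothendieckRing S) : (x - y) * z = x * z - y * z := by
  change mulHom (x - y) z = mulHom x z - mulHom y z
  simp

theorem mul_sub_aux (x y z : GrothendieckRing S) : x * (y - z) = x * y - x * z := by
  change mulHom x (y - z) = mulHom x y - mulHom x z
  simp

instance : Ring (GrothendieckRing S) :=
  { (inferInstance : AddCommGroup (GrothendieckRing S)) with
    mul := fun x y => x * y
    one := 1
    left_distrib := fun x y z => map_add (mulHom x) y z
    right_distrib := fun x y z => by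
      change mulHom (x + y) z = mulHom x z + mulHom y z
      simp
    zero_mul := fun x => by
      change mulHom 0 x = 0
      simp
    mul_zero := fun x => map_zero (mulHom x)
    mul_assoc := fun x y z => by
      induction x using ind with | h1 s => ?_ | h2 a b ha hb => ?_
      · induction y using ind with | h1 t => ?_ | h2 a b ha hb => ?_
        · induction z using ind with | h1 r => ?_ | h2 a b ha hb => ?_
          · simp only [← ofAdd_mul, mul_assoc]
          · simp only [mul_sub_aux, ha, hb]
        · simp only [mul_sub_aux, sub_mul_aux, ha, hb]
      · simp only [sub_mul_aux, ha, hb]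
    one_mul := fun x => by
      induction x using ind with | h1 s => ?_ | h2 a b ha hb => ?_
      · change ofAdd 1 * ofAdd s = ofAdd s
        rw [← ofAdd_mul, one_mul]
      · rw [mul_sub_aux, ha, hb]
    mul_one := fun x => by
      induction x using ind with | h1 s => ?_ | h2 a b ha hb => ?_
      · change ofAdd s * ofAdd 1 = ofAdd s
        rw [← ofAdd_mul, mul_one]
      · rw [sub_mul_aux, ha, hb] }

instance {S : Type v} [CommSemiring S] : CommRing (GrothendieckRing S) :=
  { (inferInstance : Ring (GrothendieckRing S)) with
    mul_comm := fun x y => by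
      induction x using ind with | h1 s => ?_ | h2 a b ha hb => ?_
      · induction y using ind with | h1 t => ?_ | h2 a b ha hb => ?_
        · rw [← ofAdd_mul, mul_comm, ofAdd_mul]
        · rw [mul_sub, sub_mul, ha, hb]
      · rw [mul_sub, sub_mul, ha, hb] }

/-- A semiring homomorphism extends to the Grothendieck rings. -/
def map {T : Type*} [Semiring T] (f : S →+* T) : GrothendieckRing S →+* GrothendieckRing T :=
  { liftAdd (ofAdd.comp f.toAddMonoidHom) with
    map_one' := by
      change liftAdd _ (ofAdd 1) = ofAdd 1
      simp [liftAdd_of]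
    map_mul' := fun x y => by
      change liftAdd (ofAdd.comp f.toAddMonoidHom) (x * y) =
        liftAdd (ofAdd.comp f.toAddMonoidHom) x * liftAdd (ofAdd.comp f.toAddMonoidHom) y
      induction x using ind with | h1 s => ?_ | h2 a b ha hb => ?_
      · induction y using ind with | h1 t => ?_ | h2 a b ha hb => ?_
        · simp [← ofAdd_mul, liftAdd_of]
        · simp only [mul_sub, map_sub, ha, hb]
      · simp only [sub_mul, map_sub, ha, hb] }

theorem map_ofAdd {T : Type*} [Semiring T] (f : S →+* T) (s : S) :
    map f (ofAdd s) = ofAdd (f s) :=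
  liftAdd_of _ s

end GrothendieckRing

/-! ## Finite left `Γ`-sets and the Burnside ring -/

/-- A finite left `Γ`-set. -/
structure FinGSet (Γ : Type u) [Group Γ] where
  /-- the underlying set -/
  carrier : Type u
  /-- the left action -/
  act : MulAction Γ carrier
  fin : Finite carrier

attribute [instance] FinGSet.act FinGSet.fin

namespace FinGSet

variable {Γ : Type u} [Group Γ]

/-- Isomorphism of `Γ`-sets: there is a `Γ`-equivariant bijection. -/
def Iso (X Y : FinGSet Γ) : Prop :=
  ∃ e : X.carrier ≃ Y.carrier, ∀ (g : Γ) (x : X.carrier), e (g • x) = g • e x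

theorem Iso.refl (X : FinGSet Γ) : Iso X X := ⟨Equiv.refl _, fun _ _ => rfl⟩

theorem Iso.symm {X Y : FinGSet Γ} : Iso X Y → Iso Y X := fun ⟨e, he⟩ =>
  ⟨e.symm, fun g y => by rw [Equiv.symm_apply_eq, he, Equiv.apply_symm_apply]⟩

theorem Iso.trans {X Y Z : FinGSet Γ} : Iso X Y → Iso Y Z → Iso X Z :=
  fun ⟨e, he⟩ ⟨f, hf⟩ => ⟨e.trans f, fun g x => by simp [he, hf]⟩

theorem Iso.of_bijective {X Y : FinGSet Γ} (f : X.carrier → Y.carrier)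
    (hf : Function.Bijective f) (h : ∀ (g : Γ) (x : X.carrier), f (g • x) = g • f x) :
    Iso X Y := ⟨Equiv.ofBijective f hf, h⟩

instance setoid (Γ : Type u) [Group Γ] : Setoid (FinGSet Γ) :=
  ⟨Iso, Iso.refl, Iso.symm, Iso.trans⟩

/-- The empty `Γ`-set. -/
def empty (Γ : Type u) [Group Γ] : FinGSet Γ where
  carrier := PEmpty.{u+1}
  act := { smul := fun _ x => x, one_smul := fun _ => rfl, mul_smul := fun _ _ _ => rfl }
  fin := inferInstance

/-- The one-point `Γ`-set. -/
def point (Γ : Type u) [Group Γ] : FinGSet Γ where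
  carrier := PUnit.{u+1}
  act := { smul := fun _ x => x, one_smul := fun _ => rfl, mul_smul := fun _ _ _ => rfl }
  fin := inferInstance

/-- The disjoint union of two `Γ`-sets. -/
def sum (X Y : FinGSet Γ) : FinGSet Γ where
  carrier := X.carrier ⊕ Y.carrier
  act := inferInstance
  fin := inferInstance

/-- The direct product of two `Γ`-sets, with the diagonal action. -/
def prod (X Y : FinGSet Γ) : FinGSet Γ where
  carrier := X.carrier × Y.carrier
  act := inferInstance
  fin := inferInstance

/-- The set of left cosets `Γ/L` with left multiplication. -/
def coset [Finite Γ] (L : Subgroup Γ) : FinGSet Γ where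
  carrier := Γ ⧸ L
  act := inferInstance
  fin := inferInstance

/-- The restriction of a `Γ`-set along a homomorphism `f : Γ' → Γ`: the same set, on which `g`
acts as `f g`. -/
def res {Γ' : Type u} [Group Γ'] (f : Γ' →* Γ) (X : FinGSet Γ) : FinGSet Γ' where
  carrier := X.carrier
  act := MulAction.compHom X.carrier f
  fin := X.fin

theorem Iso.sum {X X' Y Y' : FinGSet Γ} :
    Iso X X' → Iso Y Y' → Iso (X.sum Y) (X'.sum Y') := fun ⟨e, he⟩ ⟨f, hf⟩ =>
  ⟨Equiv.sumCongr e f, by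
    rintro g (x | y)
    · exact congrArg Sum.inl (he g x)
    · exact congrArg Sum.inr (hf g y)⟩

theorem Iso.prod {X X' Y Y' : FinGSet Γ} :
    Iso X X' → Iso Y Y' → Iso (X.prod Y) (X'.prod Y') := fun ⟨e, he⟩ ⟨f, hf⟩ =>
  ⟨Equiv.prodCongr e f, fun g p => Prod.ext (he g p.1) (hf g p.2)⟩

theorem Iso.res {Γ' : Type u} [Group Γ'] (f : Γ' →* Γ) {X Y : FinGSet Γ} :
    Iso X Y → Iso (X.res f) (Y.res f) := fun ⟨e, he⟩ => ⟨e, fun g x => he (f g) x⟩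

theorem sum_assoc (X Y Z : FinGSet Γ) : Iso ((X.sum Y).sum Z) (X.sum (Y.sum Z)) :=
  ⟨Equiv.sumAssoc _ _ _, by rintro g ((x | y) | z) <;> rfl⟩

theorem sum_comm (X Y : FinGSet Γ) : Iso (X.sum Y) (Y.sum X) :=
  ⟨Equiv.sumComm _ _, by rintro g (x | y) <;> rfl⟩

theorem empty_sum (X : FinGSet Γ) : Iso ((empty Γ).sum X) X :=
  ⟨Equiv.emptySum PEmpty _, by
    rintro g (x | y)
    · exact x.elim
    · rfl⟩

theorem prod_assoc (X Y Z : FinGSet Γ) : Iso ((X.prod Y).prod Z) (X.prod (Y.prod Z)) :=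
  ⟨Equiv.prodAssoc _ _ _, fun _ _ => rfl⟩

theorem prod_comm (X Y : FinGSet Γ) : Iso (X.prod Y) (Y.prod X) :=
  ⟨Equiv.prodComm _ _, fun _ _ => rfl⟩

theorem point_prod (X : FinGSet Γ) : Iso ((point Γ).prod X) X :=
  ⟨Equiv.punitProd _, fun _ _ => rfl⟩

theorem empty_prod (X : FinGSet Γ) : Iso ((empty Γ).prod X) (empty Γ) :=
  ⟨Equiv.pemptyProd _, fun _ p => p.1.elim⟩

theorem sum_prod (X Y Z : FinGSet Γ) :
    Iso ((X.sum Y).prod Z) ((X.prod Z).sum (Y.prod Z)) :=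
  ⟨Equiv.sumProdDistrib _ _ _, by rintro g ⟨x | y, z⟩ <;> rfl⟩

end FinGSet

/-- Isomorphism classes of finite left `Γ`-sets. -/
def GSetClass (Γ : Type u) [Group Γ] : Type (u + 1) := Quotient (FinGSet.setoid Γ)

namespace GSetClass

variable {Γ : Type u} [Group Γ]

/-- The isomorphism class of a finite `Γ`-set. -/
def mk (X : FinGSet Γ) : GSetClass Γ := Quotient.mk _ X

theorem sound {X Y : FinGSet Γ} (h : X.Iso Y) : mk X = mk Y := Quotient.sound h

instance : Add (GSetClass Γ) :=
  ⟨Quotient.map₂ FinGSet.sum fun _ _ h _ _ h' => FinGSet.Iso.sum h h'⟩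

instance : Zero (GSetClass Γ) := ⟨mk (FinGSet.empty Γ)⟩

/-- Isomorphism classes of finite `Γ`-sets form a commutative semiring under disjoint union and
direct product. -/
instance : CommSemiring (GSetClass Γ) where
  nsmul := nsmulRec
  mul := Quotient.map₂ FinGSet.prod fun _ _ h _ _ h' => FinGSet.Iso.prod h h'
  one := mk (FinGSet.point Γ)
  add_assoc := by
    rintro ⟨X⟩ ⟨Y⟩ ⟨Z⟩
    exact sound (FinGSet.sum_assoc X Y Z)
  add_comm := by
    rintro ⟨X⟩ ⟨Y⟩
    exact sound (FinGSet.sum_comm X Y)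
  zero_add := by
    rintro ⟨X⟩
    exact sound (FinGSet.empty_sum X)
  add_zero := by
    rintro ⟨X⟩
    exact sound ((FinGSet.sum_comm _ _).trans (FinGSet.empty_sum X))
  mul_assoc := by
    rintro ⟨X⟩ ⟨Y⟩ ⟨Z⟩
    exact sound (FinGSet.prod_assoc X Y Z)
  mul_comm := by
    rintro ⟨X⟩ ⟨Y⟩
    exact sound (FinGSet.prod_comm X Y)
  one_mul := by
    rintro ⟨X⟩
    exact sound (FinGSet.point_prod X)
  mul_one := by
    rintro ⟨X⟩
    exact sound ((FinGSet.prod_comm _ _).trans (FinGSet.point_prod X))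
  zero_mul := by
    rintro ⟨X⟩
    exact sound (FinGSet.empty_prod X)
  mul_zero := by
    rintro ⟨X⟩
    exact sound ((FinGSet.prod_comm _ _).trans (FinGSet.empty_prod X))
  right_distrib := by
    rintro ⟨X⟩ ⟨Y⟩ ⟨Z⟩
    exact sound (FinGSet.sum_prod X Y Z)
  left_distrib := by
    rintro ⟨X⟩ ⟨Y⟩ ⟨Z⟩
    exact sound ((FinGSet.prod_comm _ _).trans ((FinGSet.sum_prod Y Z X).trans
      (FinGSet.Iso.sum (FinGSet.prod_comm _ _) (FinGSet.prod_comm _ _))))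

end GSetClass

/-- The Burnside ring `B(G)`: the Grothendieck ring of finite left `G`-sets with respect to
disjoint unions and direct products. -/
abbrev BurnsideRing (G : Type u) [Group G] : Type (u + 1) := GrothendieckRing (GSetClass G)

/-- The element `[X]` of `B(G)` given by a finite left `G`-set `X`. -/
def BurnsideRing.of {G : Type u} [Group G] (X : FinGSet G) : BurnsideRing G :=
  GrothendieckRing.ofAdd (GSetClass.mk X)

/-! ## Bifree bisets and the bifree double Burnside ring -/

/-- A finite bifree `(G, G)`-biset, regarded as a left `(G × G)`-set through
`(g, h) • x = g x h⁻¹`. Thus `(g, 1)` acts as the left multiplication by `g`, and `(1, h)` as the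
right multiplication by `h⁻¹`; both one-sided actions are free. -/
structure BifreeBiset (G : Type u) [Group G] extends FinGSet (G × G) where
  left_free : ∀ (g : G) (x : carrier), (g, (1 : G)) • x = x → g = 1
  right_free : ∀ (h : G) (x : carrier), ((1 : G), h) • x = x → h = 1

namespace BifreeBiset

variable {G : Type u} [Group G]

/-- Isomorphism of bisets. -/
def Iso (X Y : BifreeBiset G) : Prop := FinGSet.Iso X.toFinGSet Y.toFinGSet

instance setoid (G : Type u) [Group G] : Setoid (BifreeBiset G) :=
  ⟨Iso, fun X => FinGSet.Iso.refl X.toFinGSet, FinGSet.Iso.symm, FinGSet.Iso.trans⟩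

/-- The empty biset. -/
def empty (G : Type u) [Group G] : BifreeBiset G where
  toFinGSet := FinGSet.empty (G × G)
  left_free := fun _ x => x.elim
  right_free := fun _ x => x.elim

/-- The disjoint union of bisets. -/
def sum (X Y : BifreeBiset G) : BifreeBiset G where
  toFinGSet := X.toFinGSet.sum Y.toFinGSet
  left_free := by
    rintro g (x | y) h
    · exact X.left_free g x (Sum.inl_injective h)
    · exact Y.left_free g y (Sum.inr_injective h)
  right_free := by
    rintro g (x | y) h
    · exact X.right_free g x (Sum.inl_injective h)
    · exact Y.right_free g y (Sum.inr_injective h)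

/-- The biset `G`, with left and right multiplication: `(a, b)` acts on `x` as `a x b⁻¹`. -/
def unit (G : Type u) [Group G] [Finite G] : BifreeBiset G where
  carrier := G
  act :=
    { smul := fun p x => p.1 * x * p.2⁻¹
      one_smul := fun x => by
        change 1 * x * 1⁻¹ = x
        simp
      mul_smul := fun p q x => by
        change (p.1 * q.1) * x * (p.2 * q.2)⁻¹ = p.1 * (q.1 * x * q.2⁻¹) * p.2⁻¹
        group }
  fin := inferInstance
  left_free := fun g x h => by
    change g * x * 1⁻¹ = x at h
    simpa using h
  right_free := fun g x h => by
    change 1 * x * g⁻¹ = x at h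
    simpa using h

/-- The equivalence relation on `X × Y` whose classes are the orbits of `G` under
`h • (x, y) = (x h⁻¹, h y)`. -/
def tensorSetoid (X Y : BifreeBiset G) : Setoid (X.carrier × Y.carrier) where
  r p q := ∃ h : G, q = (((1 : G), h) • p.1, (h, (1 : G)) • p.2)
  iseqv :=
    { refl := fun p => ⟨1, Prod.ext (one_smul (G × G) p.1).symm (one_smul (G × G) p.2).symm⟩
      symm := by
        rintro p q ⟨h, rfl⟩
        refine ⟨h⁻¹, Prod.ext ?_ ?_⟩ <;> simp [← mul_smul, ← Prod.one_eq_mk]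
      trans := by
        rintro p q r ⟨h, rfl⟩ ⟨k, rfl⟩
        exact ⟨k * h, Prod.ext (by simp [← mul_smul]) (by simp [← mul_smul])⟩ }

/-- The tensor product `X ×_G Y` of bisets: the set of orbits of `G` on `X × Y` under
`h • (x, y) = (x h⁻¹, h y)`, with `a (x ×_G y) b = (a x) ×_G (y b)`. -/
def tensor (X Y : BifreeBiset G) : BifreeBiset G where
  carrier := Quotient (tensorSetoid X Y)
  act :=
    { smul := fun p => Quotient.map (fun z => ((p.1, (1 : G)) • z.1, ((1 : G), p.2) • z.2)) (by
        rintro z w ⟨h, rfl⟩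
        exact ⟨h, Prod.ext (by simp [← mul_smul]) (by simp [← mul_smul])⟩)
      one_smul := by
        rintro ⟨z⟩
        exact congrArg (Quotient.mk _) (Prod.ext (one_smul (G × G) z.1) (one_smul (G × G) z.2))
      mul_smul := by
        rintro p q ⟨z⟩
        exact congrArg (Quotient.mk _) (Prod.ext (by simp [← mul_smul]) (by simp [← mul_smul])) }
  fin := inferInstance
  left_free := by
    rintro g ⟨x, y⟩ h
    obtain ⟨k, hk⟩ := Quotient.exact h
    have h1 := congrArg Prod.fst hk
    have h2 := congrArg Prod.snd hk
    obtain rfl : k = 1 := Y.left_free k y (by simpa [← mul_smul] using h2.symm)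
    exact X.left_free g x (by simpa [← mul_smul] using h1.symm)
  right_free := by
    rintro g ⟨x, y⟩ h
    obtain ⟨k, hk⟩ := Quotient.exact h
    have h1 := congrArg Prod.fst hk
    have h2 := congrArg Prod.snd hk
    obtain rfl : k = 1 := X.right_free k x (by simpa [← mul_smul] using h1.symm)
    exact Y.right_free g y (by simpa [← mul_smul] using h2.symm)

/-- The class `x ×_G y` in the tensor product. -/
def tmk {X Y : BifreeBiset G} (x : X.carrier) (y : Y.carrier) : (X.tensor Y).carrier :=
  Quotient.mk (tensorSetoid X Y) (x, y)

theorem smul_tmk {X Y : BifreeBiset G} (p : G × G) (x : X.carrier) (y : Y.carrier) :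
    p • tmk x y = tmk ((p.1, (1 : G)) • x) (((1 : G), p.2) • y) := rfl

theorem tmk_eq {X Y : BifreeBiset G} (h : G) (x : X.carrier) (y : Y.carrier) :
    tmk (((1 : G), h) • x) ((h, (1 : G)) • y) = tmk x y :=
  (Quotient.sound ⟨h, rfl⟩ : Quotient.mk (tensorSetoid X Y) (x, y) = _).symm

theorem tmk_ind {X Y : BifreeBiset G} {p : (X.tensor Y).carrier → Prop}
    (h : ∀ x y, p (tmk x y)) (z : (X.tensor Y).carrier) : p z :=
  Quotient.inductionOn z fun w => h w.1 w.2

/-- Maps out of the tensor product. -/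
def tlift {X Y : BifreeBiset G} {A : Type*} (f : X.carrier → Y.carrier → A)
    (hf : ∀ (h : G) x y, f (((1 : G), h) • x) ((h, (1 : G)) • y) = f x y) :
    (X.tensor Y).carrier → A :=
  Quotient.lift (fun z => f z.1 z.2) (by
    rintro z w ⟨h, rfl⟩
    exact (hf h z.1 z.2).symm)

theorem tlift_tmk {X Y : BifreeBiset G} {A : Type*} (f : X.carrier → Y.carrier → A)
    (hf : ∀ (h : G) x y, f (((1 : G), h) • x) ((h, (1 : G)) • y) = f x y) (x y) :
    tlift f hf (tmk x y) = f x y := rfl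

/-- A balanced equivariant surjection whose fibres are the orbits induces an isomorphism from the
tensor product. -/
theorem tensor_iso {X Y Z : BifreeBiset G} (f : X.carrier → Y.carrier → Z.carrier)
    (hf : ∀ (h : G) x y, f (((1 : G), h) • x) ((h, (1 : G)) • y) = f x y)
    (hi : ∀ x y x' y', f x y = f x' y' →
      ∃ h : G, x' = ((1 : G), h) • x ∧ y' = (h, (1 : G)) • y)
    (hs : ∀ z, ∃ x y, f x y = z)
    (he : ∀ (a b : G) x y, f ((a, (1 : G)) • x) (((1 : G), b) • y) = (a, b) • f x y) :
    Iso (X.tensor Y) Z := by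
  refine FinGSet.Iso.of_bijective (tlift f hf) ⟨?_, ?_⟩ ?_
  · intro z w
    induction z using tmk_ind with | h x y => ?_
    induction w using tmk_ind with | h x' y' => ?_
    intro h
    obtain ⟨k, rfl, rfl⟩ := hi x y x' y' h
    exact (tmk_eq k x y).symm
  · intro z
    obtain ⟨x, y, rfl⟩ := hs z
    exact ⟨tmk x y, rfl⟩
  · intro p z
    induction z using tmk_ind with | h x y => ?_
    exact he p.1 p.2 x y

theorem Iso.sum {X X' Y Y' : BifreeBiset G} :
    Iso X X' → Iso Y Y' → Iso (X.sum Y) (X'.sum Y') := FinGSet.Iso.sum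

theorem Iso.tensor {X X' Y Y' : BifreeBiset G} :
    Iso X X' → Iso Y Y' → Iso (X.tensor Y) (X'.tensor Y') := fun ⟨e, he⟩ ⟨f, hf⟩ => by
  refine tensor_iso (Z := X'.tensor Y') (fun x y => tmk (e x) (f y)) ?_ ?_ ?_ ?_
  · intro h x y
    rw [he, hf, tmk_eq]
  · intro x y x' y' h
    obtain ⟨k, hk⟩ := Quotient.exact h
    refine ⟨k, e.injective ?_, f.injective ?_⟩
    · rw [he]
      exact congrArg Prod.fst hk
    · rw [hf]
      exact congrArg Prod.snd hk
  · intro z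
    induction z using tmk_ind with | h x y => ?_
    exact ⟨e.symm x, f.symm y, by simp⟩
  · intro a b x y
    simp only [he, hf]
    rfl

theorem unit_tensor [Finite G] (X : BifreeBiset G) : Iso ((unit G).tensor X) X := by
  refine tensor_iso (X := unit G) (Y := X) (Z := X) (fun (g : G) x => (g, (1 : G)) • x) ?_ ?_ ?_ ?_
  · intro h (g : G) x
    change ((1 * g * h⁻¹, (1 : G)) : G × G) • (h, (1 : G)) • x = (g, (1 : G)) • x
    simp [← mul_smul]
  · intro (g : G) x (g' : G) x' h
    refine ⟨g'⁻¹ * g, ?_, ?_⟩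
    · change g' = 1 * g * (g'⁻¹ * g)⁻¹
      group
    · have h2 : (g'⁻¹, (1 : G)) • (g, (1 : G)) • x = (g'⁻¹, (1 : G)) • (g', (1 : G)) • x' :=
        congrArg (fun t => (g'⁻¹, (1 : G)) • t) h
      simp only [← mul_smul, Prod.mk_mul_mk, inv_mul_cancel, mul_one] at h2
      rw [h2, ← Prod.one_eq_mk, one_smul]
  · intro x
    exact ⟨(1 : G), x, one_smul (G × G) x⟩
  · intro a b (g : G) x
    change ((a * g * 1⁻¹, (1 : G)) : G × G) • ((1 : G), b) • x = (a, b) • (g, (1 : G)) • x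
    simp [← mul_smul]

theorem tensor_unit [Finite G] (X : BifreeBiset G) : Iso (X.tensor (unit G)) X := by
  refine tensor_iso (X := X) (Y := unit G) (Z := X)
    (fun x (g : G) => ((1 : G), g⁻¹) • x) ?_ ?_ ?_ ?_
  · intro h x (g : G)
    change (((1 : G), (h * g * 1⁻¹)⁻¹) : G × G) • ((1 : G), h) • x = ((1 : G), g⁻¹) • x
    simp [← mul_smul]
  · intro x (g : G) x' (g' : G) h
    refine ⟨g' * g⁻¹, ?_, ?_⟩
    · have h2 : ((1 : G), g') • ((1 : G), g⁻¹) • x = ((1 : G), g') • ((1 : G), g'⁻¹) • x' :=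
        congrArg (fun t => ((1 : G), g') • t) h
      simp only [← mul_smul, Prod.mk_mul_mk, mul_inv_cancel, mul_one] at h2
      rw [h2, ← Prod.one_eq_mk, one_smul]
    · change g' = (g' * g⁻¹) * g * 1⁻¹
      group
  · intro x
    exact ⟨x, (1 : G), by
      rw [inv_one]
      exact one_smul (G × G) x⟩
  · intro a b x (g : G)
    change (((1 : G), (1 * g * b⁻¹)⁻¹) : G × G) • (a, (1 : G)) • x =
      (a, b) • ((1 : G), g⁻¹) • x
    simp [← mul_smul]

theorem tensor_assoc (X Y Z : BifreeBiset G) :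
    Iso ((X.tensor Y).tensor Z) (X.tensor (Y.tensor Z)) := by
  have h1 : ∀ (h : G) (x : X.carrier) (y : Y.carrier) (z : Z.carrier),
      tmk (((1 : G), h) • x) (tmk ((h, (1 : G)) • y) z) = tmk x (tmk y z) := by
    intro h x y z
    rw [← tmk_eq (Y := Y.tensor Z) h x (tmk y z), smul_tmk]
    congr 2
    exact (one_smul (G × G) z).symm
  have h2 : ∀ (h : G) (x : X.carrier) (y : Y.carrier) (z : Z.carrier),
      tmk (tmk x (((1 : G), h) • y)) ((h, (1 : G)) • z) = tmk (tmk x y) z := by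
    intro h x y z
    rw [← tmk_eq (X := X.tensor Y) h (tmk x y) z, smul_tmk]
    congr 2
    exact (one_smul (G × G) x).symm
  let F : ((X.tensor Y).tensor Z).carrier → (X.tensor (Y.tensor Z)).carrier :=
    tlift (X := X.tensor Y) (fun w z => tlift (fun x y => tmk x (tmk y z))
      (fun h x y => h1 h x y z) w) (by
        intro h w z
        induction w using tmk_ind with | h x y => ?_
        change tmk (((1 : G), (1 : G)) • x) (tmk (((1 : G), h) • y) ((h, (1 : G)) • z)) = _
        rw [tmk_eq, ← Prod.one_eq_mk, one_smul]
        rfl)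
  let F' : (X.tensor (Y.tensor Z)).carrier → ((X.tensor Y).tensor Z).carrier :=
    tlift (Y := Y.tensor Z) (fun x w => tlift (fun y z => tmk (tmk x y) z)
      (fun h y z => h2 h x y z) w) (by
        intro h x w
        induction w using tmk_ind with | h y z => ?_
        change tmk (tmk (((1 : G), h) • x) ((h, (1 : G)) • y)) (((1 : G), (1 : G)) • z) = _
        rw [tmk_eq, ← Prod.one_eq_mk, one_smul]
        rfl)
  refine ⟨⟨F, F', ?_, ?_⟩, ?_⟩
  · intro w
    induction w using tmk_ind with | h w z => ?_
    induction w using tmk_ind with | h x y => ?_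
    rfl
  · intro w
    induction w using tmk_ind with | h x w => ?_
    induction w using tmk_ind with | h y z => ?_
    rfl
  · intro p w
    induction w using tmk_ind with | h w z => ?_
    induction w using tmk_ind with | h x y => ?_
    change tmk ((p.1, (1 : G)) • x) (tmk (((1 : G), (1 : G)) • y) (((1 : G), p.2) • z)) =
      tmk ((p.1, (1 : G)) • x) (tmk (((1 : G), (1 : G)) • y) (((1 : G), p.2) • z))
    rfl

theorem empty_tensor (X : BifreeBiset G) : Iso ((empty G).tensor X) (empty G) :=
  tensor_iso (X := empty G) (fun x _ => x) (fun _ x => x.elim) (fun x => x.elim)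
    (fun x => x.elim) (fun _ _ x => x.elim)

theorem tensor_empty (X : BifreeBiset G) : Iso (X.tensor (empty G)) (empty G) :=
  tensor_iso (Y := empty G) (fun _ x => x) (fun _ _ x => x.elim) (fun _ x => x.elim)
    (fun x => x.elim) (fun _ _ _ x => x.elim)

theorem sum_tensor (X Y Z : BifreeBiset G) :
    Iso ((X.sum Y).tensor Z) ((X.tensor Z).sum (Y.tensor Z)) := by
  refine tensor_iso (X := X.sum Y) (Y := Z) (Z := (X.tensor Z).sum (Y.tensor Z))
    (fun w z => Sum.map (fun x => tmk x z) (fun y => tmk y z) w) ?_ ?_ ?_ ?_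
  · rintro h (x | y) z
    · exact congrArg Sum.inl (tmk_eq h x z)
    · exact congrArg Sum.inr (tmk_eq h y z)
  · rintro (x | y) z (x' | y') z' h
    · obtain ⟨k, hk⟩ := Quotient.exact (Sum.inl_injective h)
      exact ⟨k, congrArg Sum.inl (congrArg Prod.fst hk), congrArg Prod.snd hk⟩
    · cases h
    · cases h
    · obtain ⟨k, hk⟩ := Quotient.exact (Sum.inr_injective h)
      exact ⟨k, congrArg Sum.inr (congrArg Prod.fst hk), congrArg Prod.snd hk⟩
  · rintro (w | w)
    · induction w using tmk_ind with | h x z => ?_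
      exact ⟨Sum.inl x, z, rfl⟩
    · induction w using tmk_ind with | h y z => ?_
      exact ⟨Sum.inr y, z, rfl⟩
  · rintro a b (x | y) z <;> rfl

theorem tensor_sum (X Y Z : BifreeBiset G) :
    Iso (X.tensor (Y.sum Z)) ((X.tensor Y).sum (X.tensor Z)) := by
  refine tensor_iso (X := X) (Y := Y.sum Z) (Z := (X.tensor Y).sum (X.tensor Z))
    (fun x w => Sum.map (fun y => tmk x y) (fun z => tmk x z) w) ?_ ?_ ?_ ?_
  · rintro h x (y | z)
    · exact congrArg Sum.inl (tmk_eq h x y)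
    · exact congrArg Sum.inr (tmk_eq h x z)
  · rintro x (y | z) x' (y' | z') h
    · obtain ⟨k, hk⟩ := Quotient.exact (Sum.inl_injective h)
      exact ⟨k, congrArg Prod.fst hk, congrArg Sum.inl (congrArg Prod.snd hk)⟩
    · cases h
    · cases h
    · obtain ⟨k, hk⟩ := Quotient.exact (Sum.inr_injective h)
      exact ⟨k, congrArg Prod.fst hk, congrArg Sum.inr (congrArg Prod.snd hk)⟩
  · rintro (w | w)
    · induction w using tmk_ind with | h x z => ?_
      exact ⟨x, Sum.inl z, rfl⟩
    · induction w using tmk_ind with | h x z => ?_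
      exact ⟨x, Sum.inr z, rfl⟩
  · rintro a b x (y | z) <;> rfl

/-- The opposite biset `X°`: the same set with `h x g := g⁻¹ x h⁻¹`, that is, the left
`(G × G)`-set on which `(h, g)` acts as `(g, h)` acts on `X`. -/
def op (X : BifreeBiset G) : BifreeBiset G where
  toFinGSet := X.toFinGSet.res (MulEquiv.prodComm : G × G ≃* G × G).toMonoidHom
  left_free := fun g x h => X.right_free g x h
  right_free := fun g x h => X.left_free g x h

theorem Iso.op {X Y : BifreeBiset G} : Iso X Y → Iso X.op Y.op := FinGSet.Iso.res _

theorem op_op (X : BifreeBiset G) : Iso X.op.op X := ⟨Equiv.refl _, fun _ _ => rfl⟩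

theorem op_sum (X Y : BifreeBiset G) : Iso (X.sum Y).op (X.op.sum Y.op) :=
  ⟨Equiv.refl _, by rintro g (x | y) <;> rfl⟩

theorem op_empty : Iso (empty G).op (empty G) := ⟨Equiv.refl _, fun _ x => x.elim⟩

theorem op_tensor (X Y : BifreeBiset G) : Iso (X.tensor Y).op (Y.op.tensor X.op) := by
  refine FinGSet.Iso.symm (tensor_iso (X := Y.op) (Y := X.op) (Z := (X.tensor Y).op)
    (fun y x => (tmk (X := X) (Y := Y) x y : (X.tensor Y).carrier)) ?_ ?_ ?_ ?_)
  · intro h y x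
    exact tmk_eq (X := X) (Y := Y) h x y
  · intro y x y' x' h
    obtain ⟨k, hk⟩ := Quotient.exact h
    exact ⟨k, congrArg Prod.snd hk, congrArg Prod.fst hk⟩
  · intro w
    induction w using tmk_ind (X := X) (Y := Y) with | h x y => ?_
    exact ⟨y, x, rfl⟩
  · intro a b y x
    rfl

end BifreeBiset

/-- Isomorphism classes of finite bifree `(G, G)`-bisets. -/
def BisetClass (G : Type u) [Group G] : Type (u + 1) := Quotient (BifreeBiset.setoid G)

namespace BisetClass

variable {G : Type u} [Group G]

/-- The isomorphism class of a bifree biset. -/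
def mk (X : BifreeBiset G) : BisetClass G := Quotient.mk _ X

theorem sound {X Y : BifreeBiset G} (h : X.Iso Y) : mk X = mk Y := Quotient.sound h

instance : Add (BisetClass G) :=
  ⟨Quotient.map₂ BifreeBiset.sum fun _ _ h _ _ h' => BifreeBiset.Iso.sum h h'⟩

instance : Zero (BisetClass G) := ⟨mk (BifreeBiset.empty G)⟩

/-- Isomorphism classes of finite bifree `(G, G)`-bisets form a semiring under disjoint union and
tensor product. -/
instance [Finite G] : Semiring (BisetClass G) where
  nsmul := nsmulRec
  mul := Quotient.map₂ BifreeBiset.tensor fun _ _ h _ _ h' => BifreeBiset.Iso.tensor h h'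
  one := mk (BifreeBiset.unit G)
  add_assoc := by
    rintro ⟨X⟩ ⟨Y⟩ ⟨Z⟩
    exact sound (FinGSet.sum_assoc _ _ _)
  add_comm := by
    rintro ⟨X⟩ ⟨Y⟩
    exact sound (FinGSet.sum_comm _ _)
  zero_add := by
    rintro ⟨X⟩
    exact sound (FinGSet.empty_sum _)
  add_zero := by
    rintro ⟨X⟩
    exact sound ((FinGSet.sum_comm _ _).trans (FinGSet.empty_sum _))
  mul_assoc := by
    rintro ⟨X⟩ ⟨Y⟩ ⟨Z⟩
    exact sound (BifreeBiset.tensor_assoc X Y Z)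
  one_mul := by
    rintro ⟨X⟩
    exact sound (BifreeBiset.unit_tensor X)
  mul_one := by
    rintro ⟨X⟩
    exact sound (BifreeBiset.tensor_unit X)
  zero_mul := by
    rintro ⟨X⟩
    exact sound (BifreeBiset.empty_tensor X)
  mul_zero := by
    rintro ⟨X⟩
    exact sound (BifreeBiset.tensor_empty X)
  right_distrib := by
    rintro ⟨X⟩ ⟨Y⟩ ⟨Z⟩
    exact sound (BifreeBiset.sum_tensor X Y Z)
  left_distrib := by
    rintro ⟨X⟩ ⟨Y⟩ ⟨Z⟩
    exact sound (BifreeBiset.tensor_sum X Y Z)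

/-- The map on isomorphism classes induced by `X ↦ X°`. -/
def op [Finite G] : BisetClass G →+ BisetClass G where
  toFun := Quotient.map BifreeBiset.op fun _ _ h => BifreeBiset.Iso.op h
  map_zero' := sound BifreeBiset.op_empty
  map_add' := by
    rintro ⟨X⟩ ⟨Y⟩
    exact sound (BifreeBiset.op_sum X Y)

theorem op_mul [Finite G] (a b : BisetClass G) : op (a * b) = op b * op a := by
  revert a b
  rintro ⟨X⟩ ⟨Y⟩
  exact sound (BifreeBiset.op_tensor X Y)

theorem op_op [Finite G] (a : BisetClass G) : op (op a) = a := by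
  revert a
  rintro ⟨X⟩
  exact sound (BifreeBiset.op_op X)

end BisetClass

/-- The bifree double Burnside ring `B^Δ(G, G)`: the Grothendieck ring of finite bifree
`(G, G)`-bisets with respect to disjoint unions and tensor products. -/
abbrev BifreeRing (G : Type u) [Group G] [Finite G] : Type (u + 1) :=
  GrothendieckRing (BisetClass G)

/-- The element `[X]` of `B^Δ(G, G)` given by a finite bifree biset `X`. -/
def BifreeRing.of {G : Type u} [Group G] [Finite G] (X : BifreeBiset G) : BifreeRing G :=
  GrothendieckRing.ofAdd (BisetClass.mk X)

/-- The anti-involution `γ ↦ γ°` of `B^Δ(G, G)`, with `[X]° = [X°]`. -/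
instance {G : Type u} [Group G] [Finite G] : StarRing (BifreeRing G) where
  star := GrothendieckRing.liftAdd (GrothendieckRing.ofAdd.comp BisetClass.op)
  star_involutive := fun x => by
    induction x using GrothendieckRing.ind with
    | h1 s => simp [GrothendieckRing.liftAdd_of, BisetClass.op_op]
    | h2 a b ha hb => rw [map_sub, map_sub, ha, hb]
  star_mul := fun x y => by
    induction x using GrothendieckRing.ind with
    | h1 s =>
      induction y using GrothendieckRing.ind with
      | h1 t =>
        rw [← GrothendieckRing.ofAdd_mul]
        simp only [GrothendieckRing.liftAdd_of, AddMonoidHom.comp_apply, BisetClass.op_mul]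
        exact GrothendieckRing.ofAdd_mul _ _
      | h2 a b ha hb => rw [mul_sub, map_sub, map_sub, ha, hb, sub_mul]
    | h2 a b ha hb => rw [sub_mul, map_sub, map_sub, ha, hb, mul_sub]
  star_add := fun x y => map_add _ x y

/-- The group `B^Δ_∘(G, G)` of orthogonal units of `B^Δ(G, G)`, that is, of the elements `γ` with
`γ° γ = 1` and `γ γ° = 1`, where `1 = [G]`. -/
abbrev orthogonalUnits (G : Type u) [Group G] [Finite G] : Submonoid (BifreeRing G) :=
  unitary (BifreeRing G)

/-! ## Twisted diagonal subgroups and the standard basis elements -/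

section Twisted

variable {G : Type u} [Group G]

/-- The twisted diagonal subgroup `Δ(R, α, S) = {(α h, h) | h ∈ S}` of `G × G`, for an isomorphism
`α : S ≃ R` between subgroups of `G`. -/
def twistedDiagonal (R S : Subgroup G) (α : S ≃* R) : Subgroup (G × G) :=
  ((R.subtype.comp α.toMonoidHom).prod S.subtype).range

theorem mem_twistedDiagonal {R S : Subgroup G} {α : S ≃* R} {p : G × G} :
    p ∈ twistedDiagonal R S α ↔ ∃ h : S, ((α h : G), (h : G)) = p := Iff.rfl

/-- The twisted diagonal subgroup `Δ(G, φ, G) = {(φ h, h) | h ∈ G}` for an automorphism `φ`. -/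
def autDiagonal (φ : MulAut G) : Subgroup (G × G) :=
  twistedDiagonal ⊤ ⊤ ((Subgroup.topEquiv.trans φ).trans Subgroup.topEquiv.symm)

theorem mem_autDiagonal {φ : MulAut G} {p : G × G} : p ∈ autDiagonal φ ↔ p.1 = φ p.2 := by
  constructor
  · rintro ⟨h, rfl⟩
    rfl
  · intro h
    exact ⟨⟨p.2, trivial⟩, Prod.ext h.symm rfl⟩

/-- The transitive bifree biset `(G × G)/Δ(R, α, S)`. -/
def BifreeBiset.coset [Finite G] (R S : Subgroup G) (α : S ≃* R) : BifreeBiset G where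
  toFinGSet := FinGSet.coset (twistedDiagonal R S α)
  left_free := by
    intro g x
    induction x using QuotientGroup.induction_on with | H p => ?_
    intro h
    obtain ⟨s, hs⟩ := (QuotientGroup.eq (s := twistedDiagonal R S α)).1 h
    have h2 : (s : G) = 1 := by simpa using congrArg Prod.snd hs
    obtain rfl : s = 1 := Subtype.ext h2
    have h1 : 1 = (g * p.1)⁻¹ * p.1 := by simpa using congrArg Prod.fst hs
    simpa using (eq_of_inv_mul_eq_one h1.symm)
  right_free := by
    intro g x
    induction x using QuotientGroup.induction_on with | H p => ?_
    intro h
    obtain ⟨s, hs⟩ := (QuotientGroup.eq (s := twistedDiagonal R S α)).1 h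
    have h2 : α s = 1 := by
      have : ((α s : R) : G) = 1 := by simpa using congrArg Prod.fst hs
      exact Subtype.ext this
    obtain rfl : s = 1 := by simpa using h2
    have h1 : 1 = (g * p.2)⁻¹ * p.2 := by simpa using congrArg Prod.snd hs
    simpa using (eq_of_inv_mul_eq_one h1.symm)

end Twisted

/-! ## The ring homomorphism `ι` -/

section Iota

variable {G : Type u} [Group G] [Finite G]

/-- The bifree biset `X × G` attached to a `G`-set `X`, with `a (x, g) b = (a x, a g b)`. -/
def BifreeBiset.tilde (X : FinGSet G) : BifreeBiset G where
  carrier := X.carrier × G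
  act :=
    { smul := fun p z => (p.1 • z.1, p.1 * z.2 * p.2⁻¹)
      one_smul := fun z => Prod.ext (one_smul G z.1) (by
        change 1 * z.2 * 1⁻¹ = z.2
        simp)
      mul_smul := fun p q z => Prod.ext (mul_smul p.1 q.1 z.1) (by
        change (p.1 * q.1) * z.2 * (p.2 * q.2)⁻¹ = p.1 * (q.1 * z.2 * q.2⁻¹) * p.2⁻¹
        group) }
  fin := inferInstance
  left_free := fun g z h => by
    have h1 : g * z.2 * 1⁻¹ = z.2 := congrArg Prod.snd h
    simpa using h1
  right_free := fun g z h => by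
    have h1 : 1 * z.2 * g⁻¹ = z.2 := congrArg Prod.snd h
    simpa using h1

theorem tilde_iso {X Y : FinGSet G} : X.Iso Y →
    (BifreeBiset.tilde X).Iso (BifreeBiset.tilde Y) := fun ⟨e, he⟩ =>
  ⟨Equiv.prodCongr e (Equiv.refl G), fun p z => Prod.ext (he p.1 z.1) rfl⟩

theorem tilde_sum (X Y : FinGSet G) : (BifreeBiset.tilde (X.sum Y)).Iso
    ((BifreeBiset.tilde X).sum (BifreeBiset.tilde Y)) :=
  ⟨Equiv.sumProdDistrib _ _ _, by rintro p ⟨x | y, z⟩ <;> rfl⟩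

theorem tilde_empty : (BifreeBiset.tilde (FinGSet.empty G)).Iso (BifreeBiset.empty G) :=
  ⟨Equiv.pemptyProd _, fun _ z => z.1.elim⟩

theorem tilde_point : (BifreeBiset.tilde (FinGSet.point G)).Iso (BifreeBiset.unit G) :=
  ⟨Equiv.punitProd _, fun _ _ => rfl⟩

theorem tilde_prod (X Y : FinGSet G) : (BifreeBiset.tilde (X.prod Y)).Iso
    ((BifreeBiset.tilde X).tensor (BifreeBiset.tilde Y)) := by
  refine FinGSet.Iso.symm (BifreeBiset.tensor_iso (X := BifreeBiset.tilde X)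
    (Y := BifreeBiset.tilde Y) (Z := BifreeBiset.tilde (X.prod Y))
    (fun (z : X.carrier × G) (w : Y.carrier × G) => (((z.1, z.2 • w.1), z.2 * w.2) :
      (X.carrier × Y.carrier) × G)) ?_ ?_ ?_ ?_)
  · intro h (z : X.carrier × G) (w : Y.carrier × G)
    change (((((1 : G) • z.1, (1 * z.2 * h⁻¹) • h • w.1), (1 * z.2 * h⁻¹) * (h * w.2 * 1⁻¹))) :
      (X.carrier × Y.carrier) × G) = ((z.1, z.2 • w.1), z.2 * w.2)
    simp [← mul_smul]
  · intro (z : X.carrier × G) (w : Y.carrier × G) (z' : X.carrier × G) (w' : Y.carrier × G) h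
    have h1 : z.1 = z'.1 := congrArg (fun t => t.1.1) h
    have h2 : z.2 • w.1 = z'.2 • w'.1 := congrArg (fun t => t.1.2) h
    have h3 : z.2 * w.2 = z'.2 * w'.2 := congrArg (fun t => t.2) h
    refine ⟨z'.2⁻¹ * z.2, Prod.ext ?_ ?_, Prod.ext ?_ ?_⟩
    · change z'.1 = (1 : G) • z.1
      rw [one_smul, h1]
    · change z'.2 = 1 * z.2 * (z'.2⁻¹ * z.2)⁻¹
      group
    · change w'.1 = (z'.2⁻¹ * z.2) • w.1
      rw [mul_smul, h2, inv_smul_smul]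
    · change w'.2 = (z'.2⁻¹ * z.2) * w.2 * 1⁻¹
      rw [mul_assoc z'.2⁻¹, h3]
      group
  · rintro ⟨⟨x, y⟩, g⟩
    exact ⟨(x, (1 : G)), (y, g), Prod.ext (Prod.ext rfl (one_smul G y)) (one_mul g)⟩
  · intro a b (z : X.carrier × G) (w : Y.carrier × G)
    change ((((a • z.1, (a * z.2 * 1⁻¹) • (1 : G) • w.1), (a * z.2 * 1⁻¹) * (1 * w.2 * b⁻¹))) :
      (X.carrier × Y.carrier) × G) = ((a • z.1, a • z.2 • w.1), a * (z.2 * w.2) * b⁻¹)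
    simp [← mul_smul, mul_assoc]

/-- The ring homomorphism `ι : B(G) → B^Δ(G, G)`. It sends `[X]` to `[X × G]`; on the standard basis
it is `[G/R] ↦ [(G × G)/Δ(R)]`, as shown in `iota_coset`. -/
def iota (G : Type u) [Group G] [Finite G] : BurnsideRing G →+* BifreeRing G :=
  GrothendieckRing.map
    { toFun := Quotient.map BifreeBiset.tilde fun _ _ h => tilde_iso h
      map_zero' := BisetClass.sound tilde_empty
      map_one' := BisetClass.sound tilde_point
      map_add' := by
        rintro ⟨X⟩ ⟨Y⟩
        exact BisetClass.sound (tilde_sum X Y)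
      map_mul' := by
        rintro ⟨X⟩ ⟨Y⟩
        exact BisetClass.sound (tilde_prod X Y) }

theorem iota_of (X : FinGSet G) :
    iota G (BurnsideRing.of X) = BifreeRing.of (BifreeBiset.tilde X) :=
  GrothendieckRing.map_ofAdd _ _

theorem of_congr {X Y : BifreeBiset G} (h : X.Iso Y) : BifreeRing.of X = BifreeRing.of Y :=
  congrArg GrothendieckRing.ofAdd (BisetClass.sound h)

theorem of_tensor (X Y : BifreeBiset G) :
    BifreeRing.of (X.tensor Y) = BifreeRing.of X * BifreeRing.of Y :=
  GrothendieckRing.ofAdd_mul (BisetClass.mk X) (BisetClass.mk Y)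

theorem iota_coset (R : Subgroup G) : iota G (BurnsideRing.of (FinGSet.coset R)) =
    BifreeRing.of (BifreeBiset.coset R R (MulEquiv.refl R)) := by
  rw [iota_of]
  refine of_congr (FinGSet.Iso.symm (FinGSet.Iso.of_bijective
    (X := (BifreeBiset.coset R R (MulEquiv.refl R)).toFinGSet)
    (Y := (BifreeBiset.tilde (FinGSet.coset R)).toFinGSet)
    (Quotient.lift (fun p : G × G => (((p.1 : G ⧸ R), p.1 * p.2⁻¹) : (G ⧸ R) × G)) ?_)
    ⟨?_, ?_⟩ ?_))
  · intro p q h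
    obtain ⟨s, hs⟩ := QuotientGroup.leftRel_apply.1 h
    have h1 : q.1 = p.1 * s := by
      rw [show (s : G) = p.1⁻¹ * q.1 from congrArg Prod.fst hs]
      group
    have h2 : q.2 = p.2 * s := by
      rw [show (s : G) = p.2⁻¹ * q.2 from congrArg Prod.snd hs]
      group
    refine Prod.ext ?_ ?_
    · change (p.1 : G ⧸ R) = (q.1 : G ⧸ R)
      rw [QuotientGroup.eq, h1]
      simp
    · change p.1 * p.2⁻¹ = q.1 * q.2⁻¹
      rw [h1, h2]
      group
  · rintro ⟨p⟩ ⟨q⟩ h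
    have h1 : (p.1 : G ⧸ R) = (q.1 : G ⧸ R) := congrArg Prod.fst h
    have h2 : p.1 * p.2⁻¹ = q.1 * q.2⁻¹ := congrArg Prod.snd h
    refine Quotient.sound (QuotientGroup.leftRel_apply.2
      ⟨⟨p.1⁻¹ * q.1, QuotientGroup.eq.1 h1⟩, Prod.ext rfl ?_⟩)
    change p.1⁻¹ * q.1 = p.2⁻¹ * q.2
    rw [inv_mul_eq_iff_eq_mul, ← mul_assoc, h2]
    group
  · rintro ⟨⟨g⟩, k⟩
    refine ⟨Quotient.mk _ (g, k⁻¹ * g), Prod.ext rfl ?_⟩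
    change g * (k⁻¹ * g)⁻¹ = k
    group
  · rintro p ⟨q⟩
    refine Prod.ext rfl ?_
    change (p.1 * q.1) * (p.2 * q.2)⁻¹ = p.1 * (q.1 * q.2⁻¹) * p.2⁻¹
    group

end Iota

/-! ## The outer automorphism group and its action on the Burnside ring -/

section Outer

variable {G : Type u} [Group G]

instance innNormal (G : Type u) [Group G] : (MulAut.conj : G →* MulAut G).range.Normal where
  conj_mem := by
    rintro _ ⟨g, rfl⟩ φ
    refine ⟨φ g, ?_⟩
    ext x
    simp [MulAut.mul_apply]

/-- The outer automorphism group `Out(G) = Aut(G)/Inn(G)`. -/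
abbrev Out (G : Type u) [Group G] : Type u := MulAut G ⧸ (MulAut.conj : G →* MulAut G).range

theorem res_sum {Γ Γ' : Type u} [Group Γ] [Group Γ'] (f : Γ' →* Γ) (X Y : FinGSet Γ) :
    ((X.sum Y).res f).Iso ((X.res f).sum (Y.res f)) :=
  ⟨Equiv.refl _, by rintro g (x | y) <;> rfl⟩

/-- The endomorphism of `B(G)` given by restriction of `G`-sets along an endomorphism of `G`. -/
def resHom (f : G →* G) : BurnsideRing G →+* BurnsideRing G :=
  GrothendieckRing.map
    { toFun := Quotient.map (FinGSet.res f) fun _ _ h => FinGSet.Iso.res f h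
      map_zero' := GSetClass.sound ⟨Equiv.refl _, fun _ x => x.elim⟩
      map_one' := GSetClass.sound ⟨Equiv.refl _, fun _ _ => rfl⟩
      map_add' := by
        rintro ⟨X⟩ ⟨Y⟩
        exact GSetClass.sound (res_sum f X Y)
      map_mul' := by
        rintro ⟨X⟩ ⟨Y⟩
        exact GSetClass.sound ⟨Equiv.refl _, fun _ _ => rfl⟩ }

theorem resHom_of (f : G →* G) (X : FinGSet G) :
    resHom f (BurnsideRing.of X) = BurnsideRing.of (X.res f) :=
  GrothendieckRing.map_ofAdd _ _

theorem ringHom_ext {T : Type*} [Ring T] {f g : BurnsideRing G →+* T}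
    (h : ∀ X, f (BurnsideRing.of X) = g (BurnsideRing.of X)) : f = g := by
  ext x
  induction x using GrothendieckRing.ind with
  | h1 s =>
    obtain ⟨X, rfl⟩ := Quotient.exists_rep s
    exact h X
  | h2 a b ha hb => rw [map_sub, map_sub, ha, hb]

theorem burnside_of_congr {G : Type u} [Group G] {X Y : FinGSet G} (h : X.Iso Y) : BurnsideRing.of X = BurnsideRing.of Y :=
  congrArg GrothendieckRing.ofAdd (GSetClass.sound h)

/-- The action of `Aut(G)` on `B(G)` by ring automorphisms: `φ` sends `[X]` to the class of the set
`X` on which `g` acts as `φ⁻¹ g` acts on `X`. -/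
def autAct (G : Type u) [Group G] : MulAut G →* (BurnsideRing G →+* BurnsideRing G) where
  toFun φ := resHom (MulEquiv.toMonoidHom φ⁻¹)
  map_one' := ringHom_ext fun X => by
    rw [resHom_of]
    exact burnside_of_congr ⟨Equiv.refl _, fun _ _ => rfl⟩
  map_mul' φ ψ := ringHom_ext fun X => by
    rw [RingHom.mul_def, RingHom.comp_apply, resHom_of, resHom_of, resHom_of]
    refine burnside_of_congr ⟨Equiv.refl _, fun g (x : X.carrier) => ?_⟩
    change (((φ * ψ)⁻¹ : MulAut G) g) • x =
      ((ψ⁻¹ : MulAut G) ((φ⁻¹ : MulAut G) g)) • x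
    rw [mul_inv_rev, MulAut.mul_apply]

/-- The action of `Out(G)` on `B(G)` by ring automorphisms. On the standard basis it is
`[G/R] ↦ [G/φ(R)]`, as shown in `outAct_coset`. -/
def outAct (G : Type u) [Group G] : Out G →* (BurnsideRing G →+* BurnsideRing G) :=
  QuotientGroup.lift _ (autAct G) (by
    rintro _ ⟨a, rfl⟩
    refine ringHom_ext fun X => ?_
    change resHom (MulEquiv.toMonoidHom (MulAut.conj a)⁻¹) (BurnsideRing.of X) = BurnsideRing.of X
    rw [resHom_of]
    refine burnside_of_congr ⟨MulAction.toPerm (β := X.carrier) a, fun g (x : X.carrier) => ?_⟩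
    change a • ((MulAut.conj a)⁻¹ g) • x = g • a • x
    rw [MulAut.conj_inv_apply, ← mul_smul, ← mul_smul]
    congr 1
    group)

theorem outAct_coset [Finite G] (φ : MulAut G) (R : Subgroup G) :
    outAct G (φ : Out G) (BurnsideRing.of (FinGSet.coset R)) =
      BurnsideRing.of (FinGSet.coset (R.map (MulEquiv.toMonoidHom φ))) := by
  change resHom (MulEquiv.toMonoidHom φ⁻¹) _ = _
  rw [resHom_of]
  refine burnside_of_congr (FinGSet.Iso.of_bijective
    (X := (FinGSet.coset R).res (MulEquiv.toMonoidHom φ⁻¹))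
    (Y := FinGSet.coset (R.map (MulEquiv.toMonoidHom φ)))
    (Quotient.lift (fun g : G => ((φ g : G) : G ⧸ R.map (MulEquiv.toMonoidHom φ))) ?_)
    ⟨?_, ?_⟩ ?_)
  · intro a b h
    have h1 := QuotientGroup.leftRel_apply.1 h
    exact QuotientGroup.eq.2 ⟨a⁻¹ * b, h1, by simp⟩
  · rintro ⟨a⟩ ⟨b⟩ h
    obtain ⟨r, hr, hr'⟩ := QuotientGroup.eq.1 h
    refine Quotient.sound (QuotientGroup.leftRel_apply.2 ?_)
    have : r = a⁻¹ * b := φ.injective (by simpa using hr')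
    exact this ▸ hr
  · rintro ⟨g⟩
    exact ⟨Quotient.mk _ (φ.symm g), congrArg (Quotient.mk _) (φ.apply_symm_apply g)⟩
  · rintro g ⟨a⟩
    refine congrArg (Quotient.mk _) ?_
    change φ ((φ⁻¹ : MulAut G) g * a) = g * φ a
    rw [map_mul, MulAut.apply_inv_self]

end Outer

/-! ## The homomorphisms `η` and `ρ` -/

section EtaRho

variable {G : Type u} [Group G] [Finite G]

/-- The biset `(G × G)/Δ(G, φ, G)` for an automorphism `φ` of `G`. -/
def BifreeBiset.autCoset (φ : MulAut G) : BifreeBiset G :=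
  BifreeBiset.coset ⊤ ⊤ ((Subgroup.topEquiv.trans φ).trans Subgroup.topEquiv.symm)

/-- An auxiliary model of `(G × G)/Δ(G, φ, G)`: the set `G` with `a x b = a x φ(b)`. -/
def BifreeBiset.twist (φ : MulAut G) : BifreeBiset G where
  carrier := G
  act :=
    { smul := fun p x => p.1 * x * (φ p.2)⁻¹
      one_smul := fun x => by
        change 1 * x * (φ 1)⁻¹ = x
        simp
      mul_smul := fun p q x => by
        change (p.1 * q.1) * x * (φ (p.2 * q.2))⁻¹ = p.1 * (q.1 * x * (φ q.2)⁻¹) * (φ p.2)⁻¹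
        rw [map_mul]
        group }
  fin := inferInstance
  left_free := fun g x h => by
    change g * x * (φ 1)⁻¹ = x at h
    simpa using h
  right_free := fun g x h => by
    change 1 * x * (φ g)⁻¹ = x at h
    simpa using h

theorem autCoset_iso (φ : MulAut G) :
    (BifreeBiset.autCoset φ).Iso (BifreeBiset.twist φ) := by
  refine FinGSet.Iso.of_bijective
    (X := (BifreeBiset.autCoset φ).toFinGSet) (Y := (BifreeBiset.twist φ).toFinGSet)
    (Quotient.lift (fun p : G × G => (p.1 * (φ p.2)⁻¹ : G)) ?_) ⟨?_, ?_⟩ ?_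
  · intro p q h
    have h1 : p.1⁻¹ * q.1 = φ (p.2⁻¹ * q.2) :=
      mem_autDiagonal.1 (QuotientGroup.leftRel_apply.1 h)
    change p.1 * (φ p.2)⁻¹ = q.1 * (φ q.2)⁻¹
    rw [inv_mul_eq_iff_eq_mul.1 h1, map_mul, map_inv]
    group
  · rintro ⟨p⟩ ⟨q⟩ h
    have h1 : p.1 * (φ p.2)⁻¹ = q.1 * (φ q.2)⁻¹ := h
    refine Quotient.sound (QuotientGroup.leftRel_apply.2 (mem_autDiagonal.2 ?_))
    change p.1⁻¹ * q.1 = φ (p.2⁻¹ * q.2)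
    rw [show q.1 = p.1 * (φ p.2)⁻¹ * φ q.2 by rw [h1]; group, map_mul, map_inv]
    group
  · intro (g : G)
    refine ⟨Quotient.mk _ (g, (1 : G)), ?_⟩
    change g * (φ 1)⁻¹ = g
    simp
  · rintro p ⟨q⟩
    change (p.1 * q.1) * (φ (p.2 * q.2))⁻¹ = p.1 * (q.1 * (φ q.2)⁻¹) * (φ p.2)⁻¹
    rw [map_mul]
    group

theorem twist_tensor (φ ψ : MulAut G) :
    ((BifreeBiset.twist φ).tensor (BifreeBiset.twist ψ)).Iso (BifreeBiset.twist (φ * ψ)) := by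
  refine BifreeBiset.tensor_iso (X := BifreeBiset.twist φ) (Y := BifreeBiset.twist ψ)
    (Z := BifreeBiset.twist (φ * ψ)) (fun (x y : G) => (x * φ y : G)) ?_ ?_ ?_ ?_
  · intro h (x : G) (y : G)
    change (1 * x * (φ h)⁻¹) * φ (h * y * (ψ 1)⁻¹) = x * φ y
    simp
  · intro (x : G) (y : G) (x' : G) (y' : G) (h : x * φ y = x' * φ y')
    refine ⟨y' * y⁻¹, ?_, ?_⟩
    · change x' = 1 * x * (φ (y' * y⁻¹))⁻¹
      rw [eq_mul_inv_of_mul_eq h.symm, map_mul, map_inv]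
      group
    · change y' = (y' * y⁻¹) * y * (ψ 1)⁻¹
      simp
  · intro (z : G)
    refine ⟨z, (1 : G), ?_⟩
    change z * φ 1 = z
    simp
  · intro a b (x : G) (y : G)
    change (a * x * (φ 1)⁻¹) * φ (1 * y * (ψ b)⁻¹) = a * (x * φ y) * ((φ * ψ) b)⁻¹
    simp [MulAut.mul_apply, mul_assoc]

theorem twist_one : (BifreeBiset.twist (1 : MulAut G)).Iso (BifreeBiset.unit G) :=
  ⟨Equiv.refl _, fun _ _ => rfl⟩

theorem twist_conj (a : G) :
    (BifreeBiset.twist (MulAut.conj a)).Iso (BifreeBiset.unit G) := by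
  refine ⟨Equiv.mulRight (G := G) a, fun p (x : G) => ?_⟩
  change (p.1 * x * (a * p.2 * a⁻¹)⁻¹) * a = p.1 * (x * a) * p.2⁻¹
  group

theorem of_autCoset (φ : MulAut G) : BifreeRing.of (BifreeBiset.autCoset φ) =
    BifreeRing.of (BifreeBiset.twist φ) := of_congr (autCoset_iso φ)

/-- The map `φ ↦ [(G × G)/Δ(G, φ, G)]` from `Aut(G)` to `B^Δ(G, G)`. -/
def autBasis (G : Type u) [Group G] [Finite G] : MulAut G →* BifreeRing G where
  toFun φ := BifreeRing.of (BifreeBiset.autCoset φ)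
  map_one' := by
    rw [of_autCoset]
    exact of_congr twist_one
  map_mul' φ ψ := by
    rw [of_autCoset, of_autCoset, of_autCoset, ← of_tensor]
    exact (of_congr (twist_tensor φ ψ)).symm

/-- The map `φ ↦ [(G × G)/Δ(G, φ, G)]` from `Out(G)` to `B^Δ(G, G)`. -/
def outBasis (G : Type u) [Group G] [Finite G] : Out G →* BifreeRing G :=
  QuotientGroup.lift _ (autBasis G) (by
    rintro _ ⟨a, rfl⟩
    change BifreeRing.of (BifreeBiset.autCoset (MulAut.conj a)) = 1
    rw [of_autCoset]
    exact of_congr (twist_conj a))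

/-- The ring homomorphism `η : ℤ Out(G) → B^Δ(G, G)` with `φ ↦ [(G × G)/Δ(G, φ, G)]`. -/
def eta (G : Type u) [Group G] [Finite G] : MonoidAlgebra ℤ (Out G) →+* BifreeRing G :=
  (MonoidAlgebra.lift ℤ (BifreeRing G) (Out G) (outBasis G)).toRingHom

theorem eta_single (φ : MulAut G) :
    eta G (MonoidAlgebra.single (φ : Out G) 1) = BifreeRing.of (BifreeBiset.autCoset φ) := by
  change MonoidAlgebra.lift ℤ (BifreeRing G) (Out G) (outBasis G) _ = _
  rw [MonoidAlgebra.lift_single, one_smul]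
  rfl

/-- The orbits of `G × G` on the biset `X` that are isomorphic to `(G × G)/Δ(G, φ, G)` for an
automorphism `φ` with class `o`, that is, that contain a point whose stabilizer is such a
`Δ(G, φ, G)`. -/
def outOrbits (X : BifreeBiset G) (o : Out G) : Set (Set X.carrier) :=
  {O | ∃ x : X.carrier, O = MulAction.orbit (G × G) x ∧
    ∃ φ : MulAut G, (φ : Out G) = o ∧ MulAction.stabilizer (G × G) x = autDiagonal φ}

theorem outOrbits_iso {X Y : BifreeBiset G} (h : X.Iso Y) (o : Out G) :
    (outOrbits X o).ncard = (outOrbits Y o).ncard := by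
  have key : ∀ {X Y : BifreeBiset G} (e : X.carrier ≃ Y.carrier)
      (_ : ∀ (g : G × G) (x : X.carrier), e (g • x) = g • e x),
      Set.image e '' outOrbits X o ⊆ outOrbits Y o := by
    rintro X Y e he _ ⟨_, ⟨x, rfl, φ, hφ, hs⟩, rfl⟩
    refine ⟨e x, ?_, φ, hφ, ?_⟩
    · ext y
      simp only [Set.mem_image, MulAction.mem_orbit_iff]
      constructor
      · rintro ⟨_, ⟨g, rfl⟩, rfl⟩
        exact ⟨g, (he g x).symm⟩
      · rintro ⟨g, rfl⟩
        exact ⟨g • x, ⟨g, rfl⟩, he g x⟩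
    · rw [← hs]
      ext g
      simp [MulAction.mem_stabilizer_iff, ← he]
  have le : ∀ {X Y : BifreeBiset G}, X.Iso Y →
      (outOrbits X o).ncard ≤ (outOrbits Y o).ncard := by
    rintro X Y ⟨e, he⟩
    rw [← Set.ncard_image_of_injective _ e.injective.image_injective]
    exact Set.ncard_le_ncard (key e he) (Set.toFinite _)
  exact le_antisymm (le h) (le h.symm)

theorem outOrbits_sum (X Y : BifreeBiset G) (o : Out G) :
    (outOrbits (X.sum Y) o).ncard = (outOrbits X o).ncard + (outOrbits Y o).ncard := by
  have orbl : ∀ x : X.carrier, MulAction.orbit (G × G) (show (X.sum Y).carrier from Sum.inl x) =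
      Sum.inl '' MulAction.orbit (G × G) x := by
    intro x
    ext y
    constructor
    · rintro ⟨g, rfl⟩
      exact ⟨g • x, ⟨g, rfl⟩, rfl⟩
    · rintro ⟨_, ⟨g, rfl⟩, rfl⟩
      exact ⟨g, rfl⟩
  have orbr : ∀ x : Y.carrier, MulAction.orbit (G × G) (show (X.sum Y).carrier from Sum.inr x) =
      Sum.inr '' MulAction.orbit (G × G) x := by
    intro x
    ext y
    constructor
    · rintro ⟨g, rfl⟩
      exact ⟨g • x, ⟨g, rfl⟩, rfl⟩
    · rintro ⟨_, ⟨g, rfl⟩, rfl⟩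
      exact ⟨g, rfl⟩
  have stabl : ∀ x : X.carrier, MulAction.stabilizer (G × G)
      (show (X.sum Y).carrier from Sum.inl x) = MulAction.stabilizer (G × G) x := by
    intro x
    ext g
    exact Sum.inl_injective.eq_iff
  have stabr : ∀ x : Y.carrier, MulAction.stabilizer (G × G)
      (show (X.sum Y).carrier from Sum.inr x) = MulAction.stabilizer (G × G) x := by
    intro x
    ext g
    exact Sum.inr_injective.eq_iff
  have h : outOrbits (X.sum Y) o =
      Set.image Sum.inl '' outOrbits X o ∪ Set.image Sum.inr '' outOrbits Y o := by
    ext O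
    constructor
    · rintro ⟨x | x, rfl, φ, hφ, hs⟩
      · exact Or.inl ⟨_, ⟨x, rfl, φ, hφ, (stabl x).symm.trans hs⟩, (orbl x).symm⟩
      · exact Or.inr ⟨_, ⟨x, rfl, φ, hφ, (stabr x).symm.trans hs⟩, (orbr x).symm⟩
    · rintro (⟨_, ⟨x, rfl, φ, hφ, hs⟩, rfl⟩ | ⟨_, ⟨x, rfl, φ, hφ, hs⟩, rfl⟩)
      · exact ⟨Sum.inl x, (orbl x).symm, φ, hφ, (stabl x).trans hs⟩
      · exact ⟨Sum.inr x, (orbr x).symm, φ, hφ, (stabr x).trans hs⟩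
  rw [h]
  change (Set.image Sum.inl '' outOrbits X o ∪ Set.image Sum.inr '' outOrbits Y o :
    Set (Set (X.carrier ⊕ Y.carrier))).ncard = _
  rw [Set.ncard_union_eq ?_ (Set.toFinite _) (Set.toFinite _),
    Set.ncard_image_of_injective _ Sum.inl_injective.image_injective,
    Set.ncard_image_of_injective _ Sum.inr_injective.image_injective]
  rw [Set.disjoint_left]
  rintro _ ⟨_, ⟨x, rfl, -⟩, rfl⟩ ⟨_, ⟨y, rfl, -⟩, h⟩
  have : Sum.inl x ∈ (Sum.inl '' MulAction.orbit (G × G) x : Set (X.carrier ⊕ Y.carrier)) :=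
    ⟨x, MulAction.mem_orbit_self x, rfl⟩
  rw [← h] at this
  obtain ⟨z, -, hz⟩ := this
  cases hz

/-- The additive map `ρ : B^Δ(G, G) → ℤ Out(G)` sending `[X]` to the sum over the outer
automorphisms `φ` of `n φ`, where `n` is the number of orbits of `X` isomorphic to
`(G × G)/Δ(G, φ, G)`. On the standard basis, `[(G × G)/Δ(R, α, S)]` is sent to the class of `α` if
`R = S = G`, and to `0` otherwise, as shown in `rho_autCoset` and `rho_coset`. -/
def rho (G : Type u) [Group G] [Finite G] : BifreeRing G →+ MonoidAlgebra ℤ (Out G) :=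
  GrothendieckRing.liftAdd
    { toFun := Quotient.lift
        (fun X => ∑ᶠ o : Out G, MonoidAlgebra.single o ((outOrbits X o).ncard : ℤ))
        (fun X Y h => finsum_congr fun o => by rw [outOrbits_iso h])
      map_zero' := by
        refine (finsum_congr fun o => ?_).trans finsum_zero
        have : outOrbits (BifreeBiset.empty G) o = ∅ :=
          Set.eq_empty_of_forall_notMem fun _ ⟨x, _⟩ => x.elim
        rw [this]
        simp
      map_add' := by
        rintro ⟨X⟩ ⟨Y⟩
        refine (finsum_congr fun o => ?_).trans
          (finsum_add_distrib (Set.toFinite _) (Set.toFinite _))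
        rw [outOrbits_sum, Nat.cast_add, MonoidAlgebra.single_add] }

theorem rho_of (X : BifreeBiset G) : rho G (BifreeRing.of X) =
    ∑ᶠ o : Out G, MonoidAlgebra.single o ((outOrbits X o).ncard : ℤ) :=
  GrothendieckRing.liftAdd_of _ _

theorem mem_stabilizer_coset {R S : Subgroup G} {α : S ≃* R} (p q : G × G) :
    q ∈ MulAction.stabilizer (G × G)
      (show (BifreeBiset.coset R S α).carrier from ((p : (G × G) ⧸ twistedDiagonal R S α))) ↔
      p⁻¹ * q * p ∈ twistedDiagonal R S α := by
  rw [MulAction.mem_stabilizer_iff]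
  change ((q * p : G × G) : (G × G) ⧸ twistedDiagonal R S α) = (p : (G × G) ⧸ _) ↔ _
  rw [eq_comm, QuotientGroup.eq, mul_assoc]

theorem rho_coset (R S : Subgroup G) (α : S ≃* R) (h : ¬(R = ⊤ ∧ S = ⊤)) :
    rho G (BifreeRing.of (BifreeBiset.coset R S α)) = 0 := by
  rw [rho_of]
  refine (finsum_congr fun o => ?_).trans finsum_zero
  have : outOrbits (BifreeBiset.coset R S α) o = ∅ := by
    refine Set.eq_empty_of_forall_notMem ?_
    rintro _ ⟨⟨p⟩, rfl, φ, -, hs⟩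
    have key : ∀ g : G, p⁻¹ * (φ g, g) * p ∈ twistedDiagonal R S α := fun g =>
      (mem_stabilizer_coset p (φ g, g)).1 (hs ▸ mem_autDiagonal.2 rfl)
    refine h ⟨?_, ?_⟩
    · rw [Subgroup.eq_top_iff']
      intro g
      obtain ⟨s, hs⟩ := key (φ.symm (p.1 * g * p.1⁻¹))
      have h1 : ((α s : R) : G) = p.1⁻¹ * φ (φ.symm (p.1 * g * p.1⁻¹)) * p.1 :=
        congrArg Prod.fst hs
      rw [MulEquiv.apply_symm_apply] at h1
      rw [show g = ((α s : R) : G) by rw [h1]; group]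
      exact (α s).2
    · rw [Subgroup.eq_top_iff']
      intro g
      obtain ⟨s, hs⟩ := key (p.2 * g * p.2⁻¹)
      have h1 : (s : G) = p.2⁻¹ * (p.2 * g * p.2⁻¹) * p.2 := congrArg Prod.snd hs
      rw [show g = (s : G) by rw [h1]; group]
      exact s.2
  rw [this]
  simp

theorem rho_autCoset (φ : MulAut G) :
    rho G (BifreeRing.of (BifreeBiset.autCoset φ)) = MonoidAlgebra.single (φ : Out G) 1 := by
  have stab : ∀ (p q : G × G), q ∈ MulAction.stabilizer (G × G)
      (show (BifreeBiset.autCoset φ).carrier from ((p : (G × G) ⧸ autDiagonal φ))) ↔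
      p.1⁻¹ * q.1 * p.1 = φ (p.2⁻¹ * q.2 * p.2) := fun p q =>
    (mem_stabilizer_coset p q).trans mem_autDiagonal
  rw [rho_of, finsum_eq_single _ (φ : Out G)]
  · have : outOrbits (BifreeBiset.autCoset φ) (φ : Out G) = {Set.univ} := by
      have orb : ∀ x : (BifreeBiset.autCoset φ).carrier,
          MulAction.orbit (G × G) x = Set.univ := fun x =>
        MulAction.orbit_eq_univ (M := G × G) (α := (G × G) ⧸ autDiagonal φ) x
      refine Set.eq_singleton_iff_unique_mem.2 ⟨?_, ?_⟩
      · refine ⟨((1 : G × G) : (G × G) ⧸ autDiagonal φ), (orb _).symm, φ, rfl, ?_⟩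
        ext q
        rw [mem_autDiagonal]
        exact (stab 1 q).trans (by simp)
      · rintro _ ⟨x, rfl, -⟩
        exact orb x
    rw [this]
    simp
  · intro o ho
    have : outOrbits (BifreeBiset.autCoset φ) o = ∅ := by
      refine Set.eq_empty_of_forall_notMem ?_
      rintro _ ⟨⟨p⟩, rfl, ψ, rfl, hs⟩
      refine ho (QuotientGroup.eq.2 ?_).symm
      refine ⟨φ⁻¹ (p.1 * (φ p.2)⁻¹), ?_⟩
      ext g
      have h1 : p.1⁻¹ * ψ g * p.1 = φ (p.2⁻¹ * g * p.2) :=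
        (stab p (ψ g, g)).1 (hs ▸ mem_autDiagonal.2 rfl)
      have h2 : ψ g = p.1 * φ (p.2⁻¹ * g * p.2) * p.1⁻¹ := by
        rw [← h1]
        group
      rw [MulAut.mul_apply, h2]
      apply φ.injective
      simp [mul_assoc]
    rw [this]
    simp

end EtaRho

end BurnsideUnits

end

open BurnsideUnits

/-! For homomorphisms a, b : K → G, let m_{a,b}(γ) be the additive extension of the number of points
x of a biset with a(k) x = x b(k) for all k. It depends only on the conjugacy classes of a and b.
These marks behave like matrix entries: |G| m_{a,c}(γδ) = Σ_b m_{a,b}(γ) m_{b,c}(δ), summed over all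
b : K → G (`card_mul_bimarkHom_mul`), and the anti-involution is transposition (`bimarkHom_star`).
The mark m_{a,b}(1) is the order |C(a)| of the centralizer of the image of a if a and b are
conjugate, and 0 otherwise.

Orthogonality of γ gives Σ_b m_{a,b}(γ)² = |G| |C(a)|. By bifreeness both |C(a)| and |C(b)| divide
m_{a,b}(γ), so a nonzero mark has square at least |C(a)| |C(b)|. The class of b has |G|/|C(b)|
members, so this one class already exhausts the sum. Hence each row, and by transposition each
column, is supported on exactly one conjugacy class, with m_{a,b}(γ)² = |C(a)| |C(b)| there
(`homConj_of_bimarkHom_ne_zero`, `bimarkHom_sq_eq`): on classes, γ acts as a signed permutation.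

Everything else follows from this. Conjugating an element of the image of ι by γ gives marks
supported on conjugate pairs, and by Burnside's theorem on marks this support condition
characterizes the image of ι (`mem_range_iota`); that gives normality. Units of B(G) have marks ±1,
hence square to 1, and ι takes values fixed by the anti-involution; so units of B(G) correspond to
orthogonal units in the image of ι. For K = G and b = id, the mark m_{φ,id}(γ) is |Z(G)| times the
coefficient of ρ(γ) at φ (`bimarkHom_autHom`), so ρ(γ) has a single nonzero coefficient, equal to ±1
(`exists_rho_eq_single`). The product formula makes π multiplicative, and η is a section of π, which
yields the semidirect product. -/

noncomputable section

namespace BurnsideUnits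

/-! ## Marks of finite `Γ`-sets -/

namespace FinGSet

variable {Γ : Type u} [Group Γ]

/-- The `Γ`-subset of `X` given by an invariant predicate. -/
def sub (X : FinGSet Γ) (s : X.carrier → Prop) (hs : ∀ (g : Γ) x, s x → s (g • x)) :
    FinGSet Γ where
  carrier := {x // s x}
  act :=
    { smul := fun g x => ⟨g • x.1, hs g x.1 x.2⟩
      one_smul := fun x => Subtype.ext (one_smul Γ x.1)
      mul_smul := fun g h x => Subtype.ext (mul_smul g h x.1) }
  fin := inferInstance

theorem not_smul {X : FinGSet Γ} {s : X.carrier → Prop} (hs : ∀ (g : Γ) x, s x → s (g • x))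
    (g : Γ) (x : X.carrier) (h : ¬ s x) : ¬ s (g • x) := fun h' =>
  h (by simpa using hs g⁻¹ _ h')

open Classical in
theorem sub_sum_sub_not (X : FinGSet Γ) (s : X.carrier → Prop)
    (hs : ∀ (g : Γ) x, s x → s (g • x)) :
    Iso ((X.sub s hs).sum (X.sub (fun x => ¬ s x) (not_smul hs))) X :=
  ⟨Equiv.sumCompl s, by rintro g (x | x) <;> rfl⟩

theorem stabilizer_map {X Y : FinGSet Γ} (e : X.carrier ≃ Y.carrier)
    (he : ∀ (g : Γ) x, e (g • x) = g • e x) (x : X.carrier) :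
    MulAction.stabilizer Γ (e x) = MulAction.stabilizer Γ x := by
  ext g
  simp [MulAction.mem_stabilizer_iff, ← he]

/-- The number of points of `X` fixed by the image of `f : K → Γ`. -/
def mark {K : Type*} [Group K] (f : K →* Γ) (X : FinGSet Γ) : ℕ :=
  Nat.card {x : X.carrier // ∀ k, f k • x = x}

theorem Iso.mark_eq {K : Type*} [Group K] (f : K →* Γ) {X Y : FinGSet Γ} :
    Iso X Y → mark f X = mark f Y := fun ⟨e, he⟩ =>
  Nat.card_congr (e.subtypeEquiv fun x => forall_congr' fun k => by
    rw [← he, e.injective.eq_iff])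

theorem mark_sum {K : Type*} [Group K] (f : K →* Γ) (X Y : FinGSet Γ) :
    mark f (X.sum Y) = mark f X + mark f Y := by
  rw [mark, mark, mark, ← Nat.card_sum]
  exact Nat.card_congr ((Equiv.subtypeSum).trans (Equiv.sumCongr
    (Equiv.subtypeEquivRight fun x => forall_congr' fun k => Sum.inl_injective.eq_iff)
    (Equiv.subtypeEquivRight fun x => forall_congr' fun k => Sum.inr_injective.eq_iff)))

theorem mark_empty {K : Type*} [Group K] (f : K →* Γ) : mark f (empty Γ) = 0 := by
  have : IsEmpty {x : (empty Γ).carrier // ∀ k, f k • x = x} := ⟨fun x => x.1.elim⟩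
  exact Nat.card_of_isEmpty

theorem mark_point {K : Type*} [Group K] (f : K →* Γ) : mark f (point Γ) = 1 := by
  have : Unique {x : (point Γ).carrier // ∀ k, f k • x = x} :=
    { default := ⟨PUnit.unit, fun _ => rfl⟩
      uniq := fun _ => rfl }
  exact Nat.card_unique

theorem mark_prod {K : Type*} [Group K] (f : K →* Γ) (X Y : FinGSet Γ) :
    mark f (X.prod Y) = mark f X * mark f Y := by
  rw [mark, mark, mark, ← Nat.card_prod]
  refine Nat.card_congr (Equiv.trans (Equiv.subtypeEquivRight fun z => ?_)
    (Equiv.subtypeProdEquivProd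
      (p := fun x : X.carrier => ∀ k, f k • x = x) (q := fun y : Y.carrier => ∀ k, f k • y = y)))
  rw [← forall_and]
  exact forall_congr' fun k => Prod.ext_iff

/-! ### Burnside's theorem through point stabilizers. -/

/-- The number of points of `X` with stabilizer `L`. -/
def stabCard (X : FinGSet Γ) (L : Subgroup Γ) : ℕ :=
  Nat.card {x : X.carrier // MulAction.stabilizer Γ x = L}

theorem Iso.stabCard_eq {X Y : FinGSet Γ} (L : Subgroup Γ) :
    Iso X Y → stabCard X L = stabCard Y L := fun ⟨e, he⟩ =>
  Nat.card_congr (e.subtypeEquiv fun x => by rw [stabilizer_map e he])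

theorem stabCard_sum (X Y : FinGSet Γ) (L : Subgroup Γ) :
    stabCard (X.sum Y) L = stabCard X L + stabCard Y L := by
  have hl : ∀ x : X.carrier, MulAction.stabilizer Γ
      (show (X.sum Y).carrier from Sum.inl x) = MulAction.stabilizer Γ x := fun x => by
    ext g
    exact Sum.inl_injective.eq_iff
  have hr : ∀ y : Y.carrier, MulAction.stabilizer Γ
      (show (X.sum Y).carrier from Sum.inr y) = MulAction.stabilizer Γ y := fun y => by
    ext g
    exact Sum.inr_injective.eq_iff
  rw [stabCard, stabCard, stabCard, ← Nat.card_sum]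
  exact Nat.card_congr ((Equiv.subtypeSum).trans (Equiv.sumCongr
    (Equiv.subtypeEquivRight fun x => by rw [← hl])
    (Equiv.subtypeEquivRight fun x => by rw [← hr])))

theorem orbit_invariant {X : FinGSet Γ} (x : X.carrier) (g : Γ) (y : X.carrier)
    (h : y ∈ MulAction.orbit Γ x) : g • y ∈ MulAction.orbit Γ x := by
  obtain ⟨k, rfl⟩ := h
  exact ⟨g * k, mul_smul g k x⟩

/-- A transitive set is determined by one stabilizer: g • x ↦ g • y is well defined and injective
because both orbits identify the same group elements. -/
theorem orbit_iso {X Y : FinGSet Γ} {x : X.carrier} {y : Y.carrier}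
    (h : MulAction.stabilizer Γ x = MulAction.stabilizer Γ y) :
    Iso (X.sub (· ∈ MulAction.orbit Γ x) (orbit_invariant x))
      (Y.sub (· ∈ MulAction.orbit Γ y) (orbit_invariant y)) := by
  have key : ∀ a b : Γ, a • x = b • x ↔ a • y = b • y := fun a b => by
    have : b⁻¹ * a ∈ MulAction.stabilizer Γ x ↔ b⁻¹ * a ∈ MulAction.stabilizer Γ y := by rw [h]
    simpa [MulAction.mem_stabilizer_iff, mul_smul, inv_smul_eq_iff] using this
  choose c hc using fun z : {z // z ∈ MulAction.orbit Γ x} => z.2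
  refine Iso.of_bijective
    (X := X.sub (· ∈ MulAction.orbit Γ x) (orbit_invariant x))
    (Y := Y.sub (· ∈ MulAction.orbit Γ y) (orbit_invariant y))
    (fun z => ⟨c z • y, c z, rfl⟩) ⟨?_, ?_⟩ ?_
  · intro z w hzw
    have h1 := (key _ _).2 (congrArg Subtype.val hzw)
    exact Subtype.ext ((hc z).symm.trans (h1.trans (hc w)))
  · rintro ⟨_, g, rfl⟩
    exact ⟨⟨g • x, g, rfl⟩, Subtype.ext ((key _ _).1 (hc ⟨g • x, g, rfl⟩))⟩
  · intro g z
    refine Subtype.ext (((key _ (g * c z)).1 ?_).trans (mul_smul g (c z) y))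
    refine (hc _).trans ?_
    rw [mul_smul]
    exact congrArg (g • ·) (hc z).symm

/-- A point of X has a partner in Y with the same stabilizer. Their orbits are isomorphic, and
removing both preserves the equality of counts, so induction on the size of X applies to the
complements. -/
theorem iso_of_stabCard_eq : ∀ (n : ℕ) (X Y : FinGSet Γ), Nat.card X.carrier ≤ n →
    (∀ L, stabCard X L = stabCard Y L) → Iso X Y := by
  have point_iff : ∀ (X : FinGSet Γ) (L : Subgroup Γ), stabCard X L ≠ 0 ↔
      ∃ x : X.carrier, MulAction.stabilizer Γ x = L := fun X L => by
    rw [stabCard, ← Nat.pos_iff_ne_zero, Nat.card_pos_iff]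
    exact ⟨fun h => ⟨h.1.some.1, h.1.some.2⟩, fun ⟨x, hx⟩ => ⟨⟨x, hx⟩, inferInstance⟩⟩
  intro n
  induction n with
  | zero =>
    intro X Y hX h
    have hX' : IsEmpty X.carrier := (Nat.card_eq_zero.1 (Nat.le_zero.1 hX)).resolve_right
      (fun h => h.not_finite X.fin)
    have hY' : IsEmpty Y.carrier := ⟨fun y => by
      obtain ⟨x, -⟩ := (point_iff X _).1 ((h _).symm ▸ (point_iff Y _).2 ⟨y, rfl⟩)
      exact hX'.false x⟩
    exact ⟨Equiv.equivOfIsEmpty _ _, fun _ x => (hX'.false x).elim⟩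
  | succ n ih =>
    intro X Y hX h
    rcases isEmpty_or_nonempty X.carrier with hX' | ⟨⟨x⟩⟩
    · exact ih X Y (by simp) h
    obtain ⟨y, hy⟩ := (point_iff Y _).1 (h _ ▸ (point_iff X _).2 ⟨x, rfl⟩)
    have hO := orbit_iso hy.symm
    have sX := sub_sum_sub_not X _ (orbit_invariant x)
    have sY := sub_sum_sub_not Y _ (orbit_invariant y)
    refine sX.symm.trans ((Iso.sum hO (ih _ _ ?_ fun L => ?_)).trans sY)
    · refine Nat.le_of_lt_succ (lt_of_lt_of_le ?_ hX)
      exact Finite.card_subtype_lt (x := x) (not_not.2 (MulAction.mem_orbit_self x))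
    · have h1 := h L
      rw [← sX.stabCard_eq, ← sY.stabCard_eq, stabCard_sum, stabCard_sum, hO.stabCard_eq] at h1
      exact Nat.add_left_cancel h1

-- A point is fixed by L exactly when its stabilizer contains L. This is the triangular relation
-- between marks and stabilizer counts.
open Classical in
theorem mark_subtype_eq (X : FinGSet Γ) (L : Subgroup Γ) [Fintype {L' // L < L'}] :
    mark L.subtype X = stabCard X L + ∑ L' : {L' // L < L'}, stabCard X L' := by
  simp only [stabCard]
  rw [← Nat.card_sigma, ← Nat.card_sum, mark]
  have hle : ∀ x : X.carrier, (∀ k : L, L.subtype k • x = x) ↔ L ≤ MulAction.stabilizer Γ x :=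
    fun x => ⟨fun h g hg => h ⟨g, hg⟩, fun h k => h k.2⟩
  refine Nat.card_congr
    { toFun := fun x => if h : MulAction.stabilizer Γ x.1 = L then Sum.inl ⟨x.1, h⟩ else
        Sum.inr ⟨⟨_, lt_of_le_of_ne ((hle x.1).1 x.2) (Ne.symm h)⟩, x.1, rfl⟩
      invFun := Sum.elim (fun x => ⟨x.1, (hle x.1).2 x.2.ge⟩)
        (fun z => ⟨z.2.1, (hle z.2.1).2 (z.1.2.le.trans z.2.2.ge)⟩)
      left_inv := fun x => by
        dsimp only
        split_ifs <;> rfl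
      right_inv := ?_ }
  rintro (⟨x, rfl⟩ | ⟨⟨L', hL⟩, x, hx⟩)
  · simp
  · obtain rfl : _ = L' := hx
    simp [hL.ne']

/-- Burnside's theorem: a finite `Γ`-set is determined by its marks, and the marks at the point
stabilizers suffice. -/
theorem iso_of_mark_eq [Finite Γ] {X Y : FinGSet Γ}
    (hX : ∀ x : X.carrier, mark (MulAction.stabilizer Γ x).subtype X =
      mark (MulAction.stabilizer Γ x).subtype Y)
    (hY : ∀ y : Y.carrier, mark (MulAction.stabilizer Γ y).subtype X =
      mark (MulAction.stabilizer Γ y).subtype Y) : Iso X Y := by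
  refine iso_of_stabCard_eq _ X Y le_rfl fun L => ?_
  -- Descending induction on L. If the marks agree at L, the triangular relation cancels the larger
  -- subgroups. If they differ, the hypotheses say that L is not a point stabilizer in X or Y, and
  -- both counts are 0.
  induction L using WellFoundedGT.induction with | ind L ih => ?_
  by_cases h : mark L.subtype X = mark L.subtype Y
  · let _ := Fintype.ofFinite {L' // L < L'}
    rw [mark_subtype_eq, mark_subtype_eq, Finset.sum_congr rfl fun L' _ => ih L'.1 L'.2] at h
    exact Nat.add_right_cancel h
  · have h1 : IsEmpty {x : X.carrier // MulAction.stabilizer Γ x = L} :=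
      ⟨fun x => h (x.2 ▸ hX x.1)⟩
    have h2 : IsEmpty {y : Y.carrier // MulAction.stabilizer Γ y = L} :=
      ⟨fun y => h (y.2 ▸ hY y.1)⟩
    rw [stabCard, stabCard, Nat.card_of_isEmpty, Nat.card_of_isEmpty]

end FinGSet

/-! ## Units of the Burnside ring -/

theorem GSetClass.exists_rep {Γ : Type u} [Group Γ] (s : GSetClass Γ) :
    ∃ X, GSetClass.mk X = s := Quotient.exists_rep s

theorem BurnsideRing.exists_sub {Γ : Type u} [Group Γ] (x : BurnsideRing Γ) :
    ∃ X Y, x = BurnsideRing.of X - BurnsideRing.of Y := by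
  induction x using GrothendieckRing.ind with
  | h1 s =>
    obtain ⟨X, rfl⟩ := s.exists_rep
    exact ⟨X, FinGSet.empty Γ, (sub_zero _).symm.trans
      (congrArg _ (map_zero (GrothendieckRing.ofAdd (S := GSetClass Γ))).symm)⟩
  | h2 a b ha hb =>
    obtain ⟨X, Y, rfl⟩ := ha
    obtain ⟨X', Y', rfl⟩ := hb
    have h : ∀ A B : FinGSet Γ,
        BurnsideRing.of (A.sum B) = BurnsideRing.of A + BurnsideRing.of B := fun A B =>
      map_add (GrothendieckRing.ofAdd (S := GSetClass Γ)) (GSetClass.mk A) (GSetClass.mk B)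
    refine ⟨X.sum Y', Y.sum X', ?_⟩
    rw [h, h]
    abel

/-- The ring homomorphism `B(Γ) → ℤ` counting fixed points of the image of `f : K → Γ`. -/
def markHom {Γ : Type u} [Group Γ] {K : Type*} [Group K] (f : K →* Γ) :
    BurnsideRing Γ →+* ℤ :=
  let F : GSetClass Γ →+ ℤ :=
    { toFun := Quotient.lift (fun X => (X.mark f : ℤ)) fun _ _ h =>
        congrArg _ (FinGSet.Iso.mark_eq f h)
      map_zero' := congrArg Nat.cast (FinGSet.mark_empty f)
      map_add' := by
        rintro ⟨X⟩ ⟨Y⟩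
        exact (congrArg Nat.cast (FinGSet.mark_sum f X Y)).trans (Nat.cast_add _ _) }
  { GrothendieckRing.liftAdd F with
    map_one' := (GrothendieckRing.liftAdd_of F 1).trans
      (congrArg Nat.cast (FinGSet.mark_point f))
    map_mul' := fun x y => by
      change GrothendieckRing.liftAdd F (x * y) =
        GrothendieckRing.liftAdd F x * GrothendieckRing.liftAdd F y
      induction x using GrothendieckRing.ind with
      | h1 s =>
        induction y using GrothendieckRing.ind with
        | h1 t =>
          rw [← GrothendieckRing.ofAdd_mul]
          simp only [GrothendieckRing.liftAdd_of]
          obtain ⟨X, rfl⟩ := s.exists_rep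
          obtain ⟨Y, rfl⟩ := t.exists_rep
          exact (congrArg Nat.cast (FinGSet.mark_prod f X Y)).trans (Nat.cast_mul _ _)
        | h2 a b ha hb => simp only [mul_sub, map_sub, ha, hb]
      | h2 a b ha hb => simp only [sub_mul, map_sub, ha, hb] }

theorem markHom_of {Γ : Type u} [Group Γ] {K : Type*} [Group K] (f : K →* Γ) (X : FinGSet Γ) :
    markHom f (BurnsideRing.of X) = X.mark f :=
  GrothendieckRing.liftAdd_of _ _

theorem eq_of_markHom_eq {Γ : Type u} [Group Γ] [Finite Γ] {x y : BurnsideRing Γ}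
    (h : ∀ L : Subgroup Γ, markHom L.subtype x = markHom L.subtype y) : x = y := by
  obtain ⟨X, Y, hXY⟩ := BurnsideRing.exists_sub (x - y)
  have h1 : ∀ L : Subgroup Γ, X.mark L.subtype = Y.mark L.subtype := fun L => by
    have h2 := congrArg (markHom L.subtype) hXY
    rw [map_sub, map_sub, h, sub_self, markHom_of, markHom_of] at h2
    exact_mod_cast (sub_eq_zero.1 h2.symm)
  rw [burnside_of_congr (FinGSet.iso_of_mark_eq (fun x => h1 _) (fun y => h1 _)), sub_self] at hXY
  exact sub_eq_zero.1 hXY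

/-- Each mark of a unit is a unit of ℤ, hence squares to 1, and the marks separate elements. -/
theorem BurnsideRing.unit_mul_self {Γ : Type u} [Group Γ] [Finite Γ] (x : (BurnsideRing Γ)ˣ) :
    (x : BurnsideRing Γ) * x = 1 := by
  refine eq_of_markHom_eq fun L => ?_
  rw [map_mul, map_one]
  exact Int.isUnit_mul_self (x.isUnit.map (markHom L.subtype))

/-! ## Marks of bifree bisets at pairs of homomorphisms -/

/-- Two homomorphisms to `G` are conjugate if they differ by an inner automorphism of `G`. -/
def HomConj {K G : Type*} [Group K] [Group G] (a b : K →* G) : Prop :=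
  ∃ g : G, ∀ k, b k = g * a k * g⁻¹

instance finite_monoidHom {K G : Type*} [Group K] [Group G] [Finite K] [Finite G] :
    Finite (K →* G) := DFunLike.finite _

section HomConj

variable {K G : Type*} [Group K] [Group G] {a b c : K →* G}

theorem HomConj.refl (a : K →* G) : HomConj a a := ⟨1, fun k => by simp⟩

theorem HomConj.symm : HomConj a b → HomConj b a := fun ⟨g, h⟩ =>
  ⟨g⁻¹, fun k => by rw [h]; group⟩

theorem HomConj.trans : HomConj a b → HomConj b c → HomConj a c := fun ⟨g, h⟩ ⟨g', h'⟩ =>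
  ⟨g' * g, fun k => by rw [h', h]; group⟩

/-- The order of the centralizer of the image of a homomorphism. -/
def centCard (a : K →* G) : ℕ := Nat.card (Subgroup.centralizer (a.range : Set G))

theorem centCard_pos [Finite G] (a : K →* G) : 0 < centCard a := Nat.card_pos

end HomConj

namespace BifreeBiset

variable {G : Type u} [Group G] {K : Type u} [Group K]

/-- The number of points `x` of `X` with `a(k) x = x b(k)` for all `k`. -/
def bimark (X : BifreeBiset G) (a b : K →* G) : ℕ := X.toFinGSet.mark (a.prod b)

theorem bimark_op (X : BifreeBiset G) (a b : K →* G) : X.op.bimark a b = X.bimark b a := rfl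

/-- Translation by (g, h) carries the points fixed through (a, b) to those fixed through their
conjugates. -/
theorem bimark_conj (X : BifreeBiset G) {a a' b b' : K →* G} :
    HomConj a a' → HomConj b b' → X.bimark a b = X.bimark a' b' := by
  rintro ⟨g, hg⟩ ⟨h, hh⟩
  refine Nat.card_congr ((MulAction.toPerm (α := G × G) (β := X.carrier) (g, h)).subtypeEquiv
    fun x => forall_congr' fun k => ?_)
  change (a k, b k) • x = x ↔ (a' k, b' k) • (g, h) • x = (g, h) • x
  rw [hg, hh, ← mul_smul, ← inv_smul_eq_iff, ← mul_smul]
  simp [mul_assoc]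

theorem bimark_unit_self [Finite G] (a : K →* G) : (unit G).bimark a a = centCard a := by
  refine Nat.card_congr (Equiv.subtypeEquivRight fun (g : G) => ?_)
  rw [Subgroup.mem_centralizer_iff]
  refine Iff.trans (forall_congr' fun k => ?_)
    (Set.forall_mem_range (f := a) (p := fun h => h * g = g * h)).symm
  change a k * g * (a k)⁻¹ = g ↔ _
  rw [mul_inv_eq_iff_eq_mul]

theorem bimark_unit_ne_zero [Finite G] {a b : K →* G} (h : (unit G).bimark a b ≠ 0) :
    HomConj b a := by
  obtain ⟨⟨(g : G), hg⟩⟩ := (Nat.card_pos_iff.1 (Nat.pos_of_ne_zero h)).1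
  refine ⟨g, fun k => ?_⟩
  have h1 : a k * g * (b k)⁻¹ = g := hg k
  rw [mul_inv_eq_iff_eq_mul] at h1
  rw [← h1]
  group

/-- The centralizer of the image of a acts on the counted points by left multiplication. This action
is free because X is left free, so all its orbits have the order of the centralizer. -/
theorem centCard_dvd_bimark (X : BifreeBiset G) (a b : K →* G) : centCard a ∣ X.bimark a b := by
  let C := Subgroup.centralizer (a.range : Set G)
  let F := {x : X.carrier // ∀ k, (a.prod b) k • x = x}
  have hC : ∀ (g : C) (k : K), a k * g = g * a k := fun g k =>
    Subgroup.mem_centralizer_iff.1 g.2 _ ⟨k, rfl⟩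
  let _ : MulAction C F :=
    { smul := fun g x => ⟨((g : G), (1 : G)) • x.1, fun k => by
        have h : (a.prod b) k * ((g : G), (1 : G)) = ((g : G), (1 : G)) * (a.prod b) k :=
          Prod.ext (hC g k) (by simp)
        rw [← mul_smul, h, mul_smul, x.2 k]⟩
      one_smul := fun x => Subtype.ext (one_smul (G × G) x.1)
      mul_smul := fun g h x => Subtype.ext (by
        change (((g * h : C) : G), (1 : G)) • x.1 =
          ((g : G), (1 : G)) • ((h : G), (1 : G)) • x.1
        rw [← mul_smul]
        simp) }
  have hs : ∀ x : F, MulAction.stabilizer C x = ⊥ := fun x => by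
    rw [eq_bot_iff]
    intro g hg
    exact Subgroup.mem_bot.2 (Subtype.ext (X.left_free g x.1 (congrArg Subtype.val hg)))
  exact ⟨_, (Nat.card_congr ((MulAction.selfEquivOrbitsQuotientProd hs).trans
    (Equiv.prodComm _ _))).trans (Nat.card_prod _ _)⟩

theorem bimark_tilde [Finite G] (X : FinGSet G) (a b : K →* G) :
    (tilde X).bimark a b = X.mark a * (unit G).bimark a b := by
  rw [bimark, bimark, FinGSet.mark, FinGSet.mark, FinGSet.mark, ← Nat.card_prod]
  refine Nat.card_congr (Equiv.trans (Equiv.subtypeEquivRight fun z => ?_)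
    (Equiv.subtypeProdEquivProd (p := fun x : X.carrier => ∀ k, a k • x = x)
      (q := fun y : (unit G).carrier => ∀ k, (a.prod b) k • y = y)))
  rw [← forall_and]
  exact forall_congr' fun k => Prod.ext_iff

theorem tmk_eq_iff {X Y : BifreeBiset G} {x x' : X.carrier} {y y' : Y.carrier} :
    tmk x y = tmk x' y' ↔ ∃ h : G, x' = ((1 : G), h) • x ∧ y' = (h, (1 : G)) • y :=
  Quotient.eq.trans (exists_congr fun _ => Prod.ext_iff)

/-- Double count of the pairs (x, y) whose class in the tensor product is fixed through (a, c). The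
group G acts freely on X × Y with the tensor product as orbit set, which gives the left side. Each
such pair determines a unique b : K → G for which x is fixed through (a, b) and y through (b, c),
which gives the right side. -/
theorem card_mul_bimark_tensor [Finite G] [Fintype (K →* G)] (X Y : BifreeBiset G)
    (a c : K →* G) : Nat.card G * (X.tensor Y).bimark a c =
      ∑ b : K →* G, X.bimark a b * Y.bimark b c := by
  let P := {p : X.carrier × Y.carrier // ∀ k, (a.prod c) k • tmk p.1 p.2 = tmk p.1 p.2}
  have h1 : Nat.card G * (X.tensor Y).bimark a c = Nat.card P := by
    rw [bimark, FinGSet.mark, ← Nat.card_prod]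
    have hout : ∀ z : (X.tensor Y).carrier, tmk (Quotient.out z).1 (Quotient.out z).2 = z :=
      fun z => Quotient.out_eq z
    have hmem : ∀ q : G × {z : (X.tensor Y).carrier // ∀ k, (a.prod c) k • z = z},
        ∀ k, (a.prod c) k • tmk (((1 : G), q.1) • (Quotient.out q.2.1).1)
          ((q.1, (1 : G)) • (Quotient.out q.2.1).2) =
          tmk (((1 : G), q.1) • (Quotient.out q.2.1).1)
            ((q.1, (1 : G)) • (Quotient.out q.2.1).2) := fun q => by
      rw [tmk_eq, hout]
      exact q.2.2
    -- Each orbit is parametrized by translating a chosen representative by elements of G; right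
    -- freeness of X makes the parametrization injective.
    refine Nat.card_congr (Equiv.ofBijective (β := P) (fun q =>
      ⟨(((1 : G), q.1) • (Quotient.out q.2.1).1,
        (q.1, (1 : G)) • (Quotient.out q.2.1).2), hmem q⟩) ⟨?_, ?_⟩)
    · rintro ⟨g, z⟩ ⟨g', z'⟩ h
      have hp := congrArg Subtype.val h
      have hx := congrArg Prod.fst hp
      have hy := congrArg Prod.snd hp
      dsimp only at hx hy
      have hz : z = z' := Subtype.ext (by rw [← hout z.1, ← hout z'.1, ← tmk_eq g, hx, hy, tmk_eq])
      subst hz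
      rw [← inv_smul_eq_iff, ← mul_smul] at hx
      have := X.right_free (g'⁻¹ * g) _ (by simpa using hx)
      rw [inv_mul_eq_one.1 this]
    · rintro ⟨⟨x, y⟩, hp⟩
      obtain ⟨h, hx, hy⟩ := tmk_eq_iff.1 (hout (tmk x y))
      exact ⟨(h, ⟨tmk x y, hp⟩), Subtype.ext (Prod.ext hx.symm hy.symm)⟩
  have h2 : Nat.card P = ∑ b : K →* G, X.bimark a b * Y.bimark b c := by
    simp only [bimark, FinGSet.mark]
    simp only [← Nat.card_prod]
    rw [← Nat.card_sigma]
    have hmem : ∀ q : (b : K →* G) × {x : X.carrier // ∀ k, (a.prod b) k • x = x} ×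
        {y : Y.carrier // ∀ k, (b.prod c) k • y = y},
        ∀ k, (a.prod c) k • tmk q.2.1.1 q.2.2.1 = tmk q.2.1.1 q.2.2.1 := fun q k => by
      refine (smul_tmk _ _ _).trans (tmk_eq_iff.2 ⟨q.1 k, ?_, ?_⟩)
      · rw [← mul_smul]
        simpa using (q.2.1.2 k).symm
      · rw [← mul_smul]
        simpa using (q.2.2.2 k).symm
    refine (Nat.card_congr (Equiv.ofBijective (β := P)
      (fun q => ⟨(q.2.1.1, q.2.2.1), hmem q⟩) ⟨?_, ?_⟩)).symm
    · rintro ⟨b, ⟨x, hx⟩, ⟨y, hy⟩⟩ ⟨b', ⟨x', hx'⟩, ⟨y', hy'⟩⟩ h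
      have hp := congrArg Subtype.val h
      obtain rfl : x = x' := congrArg Prod.fst hp
      obtain rfl : y = y' := congrArg Prod.snd hp
      obtain rfl : b = b' := by
        ext k
        have h3 : (a k, b k) • x = (a k, b' k) • x := (hx k).trans (hx' k).symm
        rw [← inv_smul_eq_iff, ← mul_smul] at h3
        have := X.right_free ((b' k)⁻¹ * b k) x (by simpa using h3)
        exact (inv_mul_eq_one.1 this).symm
      rfl
    · rintro ⟨⟨x, y⟩, hp⟩
      -- That k fixes the class of (x, y) means that some h in G corrects the translated pair. By
      -- right freeness h is unique, so k ↦ h is multiplicative and is the required b.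
      have h3 : ∀ k, ∃ h : G, (a k, h) • x = x ∧ (h, c k) • y = y := fun k => by
        obtain ⟨h, hx, hy⟩ := tmk_eq_iff.1 ((smul_tmk _ _ _).symm.trans (hp k))
        refine ⟨h, ?_, ?_⟩
        · rw [← mul_smul] at hx
          simpa using hx.symm
        · rw [← mul_smul] at hy
          simpa using hy.symm
      choose b hb using h3
      refine ⟨⟨MonoidHom.mk' b fun k l => ?_, ⟨x, fun k => (hb k).1⟩, ⟨y, fun k => (hb k).2⟩⟩, rfl⟩
      have h4 : (a (k * l), b (k * l)) • x = (a k, b k) • (a l, b l) • x := by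
        rw [(hb l).1, (hb k).1, (hb _).1]
      rw [← mul_smul, ← inv_smul_eq_iff, ← mul_smul] at h4
      have := X.right_free ((b k * b l)⁻¹ * b (k * l)) x (by simpa using h4)
      exact (inv_mul_eq_one.1 this).symm
  rw [h1, h2]

end BifreeBiset

theorem BisetClass.exists_rep {G : Type u} [Group G] (s : BisetClass G) :
    ∃ X, BisetClass.mk X = s := Quotient.exists_rep s

section Bimark

variable {G : Type u} [Group G] [Finite G]

theorem bifree_of_add (A B : BifreeBiset G) :
    BifreeRing.of (A.sum B) = BifreeRing.of A + BifreeRing.of B :=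
  map_add (GrothendieckRing.ofAdd (S := BisetClass G)) (BisetClass.mk A) (BisetClass.mk B)

theorem BifreeRing.exists_sub (x : BifreeRing G) :
    ∃ X Y, x = BifreeRing.of X - BifreeRing.of Y := by
  induction x using GrothendieckRing.ind with
  | h1 s =>
    obtain ⟨X, rfl⟩ := s.exists_rep
    exact ⟨X, BifreeBiset.empty G, (sub_zero _).symm.trans
      (congrArg _ (map_zero (GrothendieckRing.ofAdd (S := BisetClass G))).symm)⟩
  | h2 a b ha hb =>
    obtain ⟨X, Y, rfl⟩ := ha
    obtain ⟨X', Y', rfl⟩ := hb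
    refine ⟨X.sum Y', Y.sum X', ?_⟩
    rw [bifree_of_add, bifree_of_add]
    abel

theorem star_of (X : BifreeBiset G) : star (BifreeRing.of X) = BifreeRing.of X.op :=
  GrothendieckRing.liftAdd_of _ _

theorem one_eq_of : (1 : BifreeRing G) = BifreeRing.of (BifreeBiset.unit G) := rfl

variable {K : Type u} [Group K]

/-- The additive extension of `BifreeBiset.bimark` to `B^Δ(G, G)`. -/
def bimarkHom (a b : K →* G) : BifreeRing G →+ ℤ :=
  GrothendieckRing.liftAdd
    { toFun := Quotient.lift (fun X => (X.bimark a b : ℤ)) fun _ _ h =>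
        congrArg _ (FinGSet.Iso.mark_eq _ h)
      map_zero' := congrArg Nat.cast (FinGSet.mark_empty _)
      map_add' := by
        rintro ⟨X⟩ ⟨Y⟩
        exact (congrArg Nat.cast (FinGSet.mark_sum _ _ _)).trans (Nat.cast_add _ _) }

theorem bimarkHom_of (a b : K →* G) (X : BifreeBiset G) :
    bimarkHom a b (BifreeRing.of X) = X.bimark a b :=
  GrothendieckRing.liftAdd_of _ _

theorem bimarkHom_star (a b : K →* G) (γ : BifreeRing G) :
    bimarkHom a b (star γ) = bimarkHom b a γ := by
  obtain ⟨X, Y, rfl⟩ := BifreeRing.exists_sub γ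
  simp [star_sub, star_of, bimarkHom_of, BifreeBiset.bimark_op]

theorem bimarkHom_conj {a a' b b' : K →* G} (ha : HomConj a a') (hb : HomConj b b')
    (γ : BifreeRing G) : bimarkHom a b γ = bimarkHom a' b' γ := by
  obtain ⟨X, Y, rfl⟩ := BifreeRing.exists_sub γ
  simp [bimarkHom_of, BifreeBiset.bimark_conj _ ha hb]

theorem centCard_dvd_bimarkHom (a b : K →* G) (γ : BifreeRing G) :
    (centCard a : ℤ) ∣ bimarkHom a b γ := by
  obtain ⟨X, Y, rfl⟩ := BifreeRing.exists_sub γ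
  rw [map_sub, bimarkHom_of, bimarkHom_of]
  exact dvd_sub (Int.natCast_dvd_natCast.2 (X.centCard_dvd_bimark a b))
    (Int.natCast_dvd_natCast.2 (Y.centCard_dvd_bimark a b))

/-- The left divisibility applied to the transpose. -/
theorem centCard_dvd_bimarkHom_right (a b : K →* G) (γ : BifreeRing G) :
    (centCard b : ℤ) ∣ bimarkHom a b γ :=
  bimarkHom_star b a γ ▸ centCard_dvd_bimarkHom b a (star γ)

theorem bimarkHom_one_self (a : K →* G) : bimarkHom a a (1 : BifreeRing G) = centCard a := by
  rw [one_eq_of, bimarkHom_of, BifreeBiset.bimark_unit_self]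

theorem bimarkHom_one_of_not_homConj {a b : K →* G} (h : ¬ HomConj a b) :
    bimarkHom a b (1 : BifreeRing G) = 0 := by
  rw [one_eq_of, bimarkHom_of, Nat.cast_eq_zero]
  exact not_not.1 fun h' => h (BifreeBiset.bimark_unit_ne_zero h').symm

/-- In matrix terms, elements of the image of ι act diagonally on conjugacy classes: a point of X ×
G is fixed exactly when its X-component is fixed through a and its G-component is fixed in the biset
G. -/
theorem bimarkHom_iota (a b : K →* G) (x : BurnsideRing G) :
    bimarkHom a b (iota G x) = markHom a x * bimarkHom a b 1 := by
  obtain ⟨X, Y, rfl⟩ := BurnsideRing.exists_sub x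
  simp only [map_sub, iota_of, bimarkHom_of, markHom_of, BifreeBiset.bimark_tilde, one_eq_of]
  push_cast
  ring

/-- Summing over all homomorphisms, not over classes, avoids choosing representatives; the price is
the factor |G|. -/
theorem card_mul_bimarkHom_mul [Fintype (K →* G)] (a c : K →* G) (γ δ : BifreeRing G) :
    Nat.card G * bimarkHom a c (γ * δ) =
      ∑ b : K →* G, bimarkHom a b γ * bimarkHom b c δ := by
  have key : ∀ X Y : BifreeBiset G, Nat.card G *
      bimarkHom a c (BifreeRing.of X * BifreeRing.of Y) =
      ∑ b : K →* G, bimarkHom a b (BifreeRing.of X) * bimarkHom b c (BifreeRing.of Y) := by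
    intro X Y
    rw [← of_tensor]
    simp only [bimarkHom_of]
    exact_mod_cast BifreeBiset.card_mul_bimark_tensor X Y a c
  obtain ⟨X, X', rfl⟩ := BifreeRing.exists_sub γ
  obtain ⟨Y, Y', rfl⟩ := BifreeRing.exists_sub δ
  simp only [mul_sub, sub_mul, map_sub, Finset.sum_sub_distrib, key]

end Bimark

/-! ## Marks of orthogonal units -/

section Orthogonal

variable {G : Type u} [Group G] [Finite G] {K : Type u} [Group K]

-- Orbit-stabilizer for the conjugation action on homomorphisms, read off from the product formula
-- for 1 · 1 = 1: each b conjugate to a contributes |C(a)|², and every other b contributes 0.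
open Classical in
theorem card_conj_mul_centCard [Fintype (K →* G)] (a : K →* G) :
    (((Finset.univ.filter (HomConj a)).card : ℤ)) * centCard a = Nat.card G := by
  have h := card_mul_bimarkHom_mul a a (1 : BifreeRing G) 1
  rw [mul_one, bimarkHom_one_self] at h
  have hc : (centCard a : ℤ) ≠ 0 := by exact_mod_cast (centCard_pos a).ne'
  have h1 : ∀ b : K →* G, bimarkHom a b (1 : BifreeRing G) * bimarkHom b a 1 =
      if HomConj a b then (centCard a : ℤ) * centCard a else 0 := fun b => by
    split_ifs with hb
    · rw [← bimarkHom_conj (HomConj.refl a) hb, ← bimarkHom_conj hb (HomConj.refl a),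
        bimarkHom_one_self]
    · rw [bimarkHom_one_of_not_homConj hb, zero_mul]
  rw [Finset.sum_congr rfl fun b _ => h1 b, ← Finset.sum_filter, Finset.sum_const,
    nsmul_eq_mul, ← mul_assoc] at h
  exact (mul_right_cancel₀ hc h).symm

/-- The diagonal entry at a of the identity γγ° = 1, with γ° read as the transpose. -/
theorem sum_bimarkHom_sq [Fintype (K →* G)] (γ : orthogonalUnits G) (a : K →* G) :
    ∑ b : K →* G, bimarkHom a b (γ : BifreeRing G) ^ 2 = Nat.card G * centCard a := by
  have h := card_mul_bimarkHom_mul a a (γ : BifreeRing G) (star (γ : BifreeRing G))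
  rw [Unitary.mul_star_self_of_mem γ.2, bimarkHom_one_self] at h
  rw [h]
  exact Finset.sum_congr rfl fun b _ => by rw [bimarkHom_star, sq]

theorem le_bimarkHom_sq {γ : BifreeRing G} {a b : K →* G} (h : bimarkHom a b γ ≠ 0) :
    (centCard a : ℤ) * centCard b ≤ bimarkHom a b γ ^ 2 :=
  Int.le_of_dvd (by positivity)
    (sq (bimarkHom a b γ) ▸
      mul_dvd_mul (centCard_dvd_bimarkHom a b γ) (centCard_dvd_bimarkHom_right a b γ))

open Classical in
theorem sum_filter_homConj [Fintype (K →* G)] (γ : BifreeRing G) (a b : K →* G) :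
    ∑ c ∈ Finset.univ.filter (HomConj b), bimarkHom a c γ ^ 2 =
      (Finset.univ.filter (HomConj b)).card * bimarkHom a b γ ^ 2 := by
  rw [← nsmul_eq_mul, ← Finset.sum_const]
  exact Finset.sum_congr rfl fun c hc => by
    rw [bimarkHom_conj (HomConj.refl a) (Finset.mem_filter.1 hc).2]

/-- A class with nonzero mark contributes at least |G| |C(a)| to the row sum of squares, which is
the whole sum. Two distinct classes would contribute twice that. -/
theorem homConj_of_bimarkHom_ne_zero [Finite K] (γ : orthogonalUnits G) {a b c : K →* G}
    (hb : bimarkHom a b (γ : BifreeRing G) ≠ 0) (hc : bimarkHom a c (γ : BifreeRing G) ≠ 0) :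
    HomConj b c := by
  classical
  let _ := Fintype.ofFinite (K →* G)
  by_contra hbc
  have hd : Disjoint (Finset.univ.filter (HomConj b)) (Finset.univ.filter (HomConj c)) :=
    Finset.disjoint_left.2 fun d h1 h2 =>
      hbc ((Finset.mem_filter.1 h1).2.trans (Finset.mem_filter.1 h2).2.symm)
  have h1 : ∑ d ∈ Finset.univ.filter (HomConj b) ∪ Finset.univ.filter (HomConj c),
      bimarkHom a d (γ : BifreeRing G) ^ 2 ≤ ∑ d : K →* G, bimarkHom a d (γ : BifreeRing G) ^ 2 :=
    Finset.sum_le_sum_of_subset_of_nonneg (Finset.subset_univ _) fun _ _ _ => sq_nonneg _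
  rw [Finset.sum_union hd, sum_filter_homConj, sum_filter_homConj, sum_bimarkHom_sq] at h1
  have h2 := mul_le_mul_of_nonneg_left (le_bimarkHom_sq hb)
    (Nat.cast_nonneg (Finset.univ.filter (HomConj b)).card)
  have h3 := mul_le_mul_of_nonneg_left (le_bimarkHom_sq hc)
    (Nat.cast_nonneg (Finset.univ.filter (HomConj c)).card)
  -- Class size times centralizer order is |G|, so both lower bounds become |G| |C(a)|.
  rw [mul_comm (centCard a : ℤ), ← mul_assoc, card_conj_mul_centCard] at h2 h3
  have h4 : (0 : ℤ) < Nat.card G * centCard a := by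
    exact_mod_cast Nat.mul_pos Nat.card_pos (centCard_pos a)
  linarith

/-- Divisibility gives the lower bound. For the upper bound, the class of b contributes at most the
full row sum |G| |C(a)|, and |G| is |C(b)| times the size of that class. -/
theorem bimarkHom_sq_eq [Finite K] (γ : orthogonalUnits G) {a b : K →* G}
    (h : bimarkHom a b (γ : BifreeRing G) ≠ 0) :
    bimarkHom a b (γ : BifreeRing G) ^ 2 = centCard a * centCard b := by
  classical
  let _ := Fintype.ofFinite (K →* G)
  refine le_antisymm ?_ (le_bimarkHom_sq h)
  have h1 : ∑ d ∈ Finset.univ.filter (HomConj b), bimarkHom a d (γ : BifreeRing G) ^ 2 ≤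
      ∑ d : K →* G, bimarkHom a d (γ : BifreeRing G) ^ 2 :=
    Finset.sum_le_sum_of_subset_of_nonneg (Finset.subset_univ _) fun _ _ _ => sq_nonneg _
  rw [sum_filter_homConj, sum_bimarkHom_sq, ← card_conj_mul_centCard b, mul_assoc] at h1
  rw [mul_comm (centCard a : ℤ)]
  refine le_of_mul_le_mul_left h1 ?_
  exact_mod_cast Finset.card_pos.2 ⟨b, by simpa using HomConj.refl b⟩

theorem exists_bimarkHom_ne_zero [Finite K] (γ : orthogonalUnits G) (a : K →* G) :
    ∃ b : K →* G, bimarkHom a b (γ : BifreeRing G) ≠ 0 := by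
  let _ := Fintype.ofFinite (K →* G)
  by_contra! h
  have h1 := sum_bimarkHom_sq γ a
  simp only [h] at h1
  have h4 : (0 : ℤ) < Nat.card G * centCard a := by
    exact_mod_cast Nat.mul_pos Nat.card_pos (centCard_pos a)
  rw [Finset.sum_eq_zero fun _ _ => zero_pow two_ne_zero] at h1
  exact h4.ne h1

theorem bimarkHom_star_coe (γ : orthogonalUnits G) (a b : K →* G) :
    bimarkHom a b ((star γ : orthogonalUnits G) : BifreeRing G) =
      bimarkHom b a (γ : BifreeRing G) := bimarkHom_star a b _

theorem homConj_of_bimarkHom_ne_zero_left [Finite K] (γ : orthogonalUnits G) {a b c : K →* G}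
    (hb : bimarkHom b a (γ : BifreeRing G) ≠ 0) (hc : bimarkHom c a (γ : BifreeRing G) ≠ 0) :
    HomConj b c :=
  homConj_of_bimarkHom_ne_zero (star γ) (a := a) (by rwa [bimarkHom_star_coe])
    (by rwa [bimarkHom_star_coe])

/-- The conjugate of an element of the image of `ι` by an orthogonal unit has nonzero marks only at
pairs of conjugate homomorphisms. -/
theorem bimarkHom_conj_iota_eq_zero [Finite K] (γ : orthogonalUnits G) (x : BurnsideRing G)
    {a b : K →* G} (h : ¬ HomConj a b) :
    bimarkHom a b ((γ : BifreeRing G) * iota G x * star (γ : BifreeRing G)) = 0 := by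
  let _ := Fintype.ofFinite (K →* G)
  have hG : (Nat.card G : ℤ) ≠ 0 := by exact_mod_cast Nat.card_pos.ne'
  refine (mul_eq_zero.1 ((card_mul_bimarkHom_mul a b _ _).trans
    (Finset.sum_eq_zero fun d _ => ?_))).resolve_left hG
  rw [bimarkHom_star]
  -- A nonzero contribution needs nonzero marks of γ at (a, c) and (b, d) and of the middle factor
  -- at (c, d). The last makes c and d conjugate, and then column uniqueness makes a and b
  -- conjugate.
  by_cases hd : bimarkHom b d (γ : BifreeRing G) = 0
  · rw [hd, mul_zero]
  refine mul_eq_zero_of_left ((mul_eq_zero.1 ((card_mul_bimarkHom_mul a d _ _).trans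
    (Finset.sum_eq_zero fun c _ => ?_))).resolve_left hG) _
  by_cases hc : bimarkHom a c (γ : BifreeRing G) = 0
  · rw [hc, zero_mul]
  by_cases hcd : HomConj c d
  · refine absurd (homConj_of_bimarkHom_ne_zero_left γ (a := d) ?_ hd) h
    rwa [← bimarkHom_conj (HomConj.refl a) hcd]
  · rw [bimarkHom_iota, bimarkHom_one_of_not_homConj hcd, mul_zero, mul_zero]

end Orthogonal

/-! ## The image of `ι` -/

section ConjPoint

variable {G : Type u} [Group G]

/-- The sub-biset of `X` given by an invariant predicate. -/
def BifreeBiset.sub (X : BifreeBiset G) (s : X.carrier → Prop)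
    (hs : ∀ (g : G × G) x, s x → s (g • x)) : BifreeBiset G where
  toFinGSet := X.toFinGSet.sub s hs
  left_free := fun g x h => X.left_free g x.1 (congrArg Subtype.val h)
  right_free := fun g x h => X.right_free g x.1 (congrArg Subtype.val h)

/-- The stabilizer of the point `x` of a biset is contained in a conjugate of the diagonal. -/
def ConjPoint {X : BifreeBiset G} (x : X.carrier) : Prop :=
  ∃ g : G, ∀ p : G × G, p • x = x → p.1 = g * p.2 * g⁻¹

theorem ConjPoint.smul {X : BifreeBiset G} (q : G × G) (x : X.carrier) :
    ConjPoint x → ConjPoint (q • x) := by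
  rintro ⟨g, hg⟩
  refine ⟨q.1 * g * q.2⁻¹, fun p hp => ?_⟩
  have h := hg (q⁻¹ * p * q) (by rw [mul_smul, mul_smul, hp, inv_smul_smul])
  have h' : q.1⁻¹ * p.1 * q.1 = g * (q.2⁻¹ * p.2 * q.2) * g⁻¹ := h
  have h2 : p.1 = q.1 * (q.1⁻¹ * p.1 * q.1) * q.1⁻¹ := by group
  rw [h2, h']
  group

/-- An equivariant map from X to the biset G exists as soon as each stabilizer fixes some element of
G, which is what `ConjPoint` says. The map is prescribed on one representative per orbit and
extended by equivariance. -/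
theorem exists_map_unit {X : BifreeBiset G} (h : ∀ x : X.carrier, ConjPoint x) :
    ∃ q : X.carrier → G, ∀ (p : G × G) x, q (p • x) = p.1 * q x * p.2⁻¹ := by
  let r : X.carrier → X.carrier := fun x =>
    Quotient.out (Quotient.mk (MulAction.orbitRel (G × G) X.carrier) x)
  have hr : ∀ x, ∃ p : G × G, p • r x = x := fun x => by
    have h1 : (MulAction.orbitRel (G × G) X.carrier).r (r x) x := Quotient.exact (Quotient.out_eq _)
    obtain ⟨p, hp⟩ := MulAction.orbitRel_apply.1 h1
    exact ⟨p⁻¹, by rw [← hp]; exact inv_smul_smul p x⟩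
  have hr' : ∀ (p : G × G) x, r (p • x) = r x := fun p x =>
    congrArg Quotient.out (Quotient.sound ⟨p, rfl⟩)
  choose p hp using hr
  choose g hg using h
  refine ⟨fun x => (p x).1 * g (r x) * (p x).2⁻¹, fun k x => ?_⟩
  -- Both p (k • x) and k * p x carry the representative to k • x, so they differ by an element of
  -- its stabilizer, where g (r x) gives the needed relation.
  have h1 := hg (r x) ((p (k • x))⁻¹ * (k * p x)) (by
    rw [mul_smul, mul_smul, hp, inv_smul_eq_iff]
    nth_rewrite 1 [← hp (k • x)]
    rw [hr'])
  have h2 : (p (k • x)).1⁻¹ * (k.1 * (p x).1) =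
      g (r x) * ((p (k • x)).2⁻¹ * (k.2 * (p x).2)) * (g (r x))⁻¹ := h1
  rw [inv_mul_eq_iff_eq_mul, ← eq_mul_inv_iff_mul_eq] at h2
  simp only [hr']
  have h3 : k.1 * ((p x).1 * g (r x) * (p x).2⁻¹) * k.2⁻¹ =
      k.1 * (p x).1 * g (r x) * (p x).2⁻¹ * k.2⁻¹ := by group
  rw [h3, h2]
  group

end ConjPoint

section IotaRange

variable {G : Type u} [Group G] [Finite G]

/-- The point (x, g) equals (x, 1) g, and inverting g exchanges left and right; moving x to g⁻¹ x
keeps the map equivariant. -/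
theorem tilde_op (X : FinGSet G) :
    (BifreeBiset.tilde X).op.Iso (BifreeBiset.tilde X) := by
  refine FinGSet.Iso.of_bijective (X := (BifreeBiset.tilde X).op.toFinGSet)
    (Y := (BifreeBiset.tilde X).toFinGSet)
    (fun (z : X.carrier × G) => ((z.2⁻¹ • z.1, z.2⁻¹) : X.carrier × G)) ⟨?_, ?_⟩ ?_
  · rintro ⟨x, g⟩ ⟨x', g'⟩ h
    obtain rfl : g = g' := inv_injective (congrArg Prod.snd h)
    rw [show x = x' from MulAction.injective g⁻¹ (congrArg Prod.fst h)]
  · rintro ⟨x, g⟩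
    exact ⟨(g⁻¹ • x, g⁻¹), Prod.ext (by simp) (inv_inv g)⟩
  · rintro p ⟨x, g⟩
    refine Prod.ext ?_ ?_
    · change (p.2 * g * p.1⁻¹)⁻¹ • p.2 • x = p.1 • g⁻¹ • x
      simp [← mul_smul, mul_assoc]
    · change (p.2 * g * p.1⁻¹)⁻¹ = p.1 * g⁻¹ * p.2⁻¹
      group

theorem star_iota (x : BurnsideRing G) : star (iota G x) = iota G x := by
  obtain ⟨X, Y, rfl⟩ := BurnsideRing.exists_sub x
  simp only [map_sub, star_sub, iota_of, star_of]
  rw [of_congr (tilde_op X), of_congr (tilde_op Y)]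

theorem iota_injective : Function.Injective (iota G) := by
  intro x y h
  refine eq_of_markHom_eq fun L => ?_
  have h1 := congrArg (bimarkHom L.subtype L.subtype) h
  rw [bimarkHom_iota, bimarkHom_iota, bimarkHom_one_self] at h1
  exact mul_right_cancel₀ (by exact_mod_cast (centCard_pos L.subtype).ne') h1

/-- Since ι(x) is fixed by the anti-involution and ι is injective, orthogonality of ι(x) says x² =
1, which every unit of B(G) satisfies. -/
theorem iota_mem_orthogonalUnits_iff (x : BurnsideRing G) :
    iota G x ∈ orthogonalUnits G ↔ IsUnit x := by
  rw [Unitary.mem_iff, star_iota, and_self, ← map_mul, ← map_one (iota G), iota_injective.eq_iff]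
  refine ⟨fun h => IsUnit.of_mul_eq_one x h, ?_⟩
  rintro ⟨u, rfl⟩
  exact BurnsideRing.unit_mul_self u

/-- A biset all of whose point stabilizers are contained in conjugates of the diagonal comes from a
`G`-set. -/
theorem of_mem_range_iota {X : BifreeBiset G} (h : ∀ x : X.carrier, ConjPoint x) :
    BifreeRing.of X ∈ Set.range (iota G) := by
  obtain ⟨q, hq⟩ := exists_map_unit h
  -- The fibre over 1 of the map to G, with the diagonal action. Every point of X is moved into this
  -- fibre by a unique right translation, so X is U × G.
  let U : FinGSet G :=
    { carrier := {x : X.carrier // q x = 1}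
      act :=
        { smul := fun g x => ⟨(g, g) • x.1, by rw [hq, x.2]; simp⟩
          one_smul := fun x => Subtype.ext (one_smul (G × G) x.1)
          mul_smul := fun g k x => Subtype.ext (mul_smul (g, g) (k, k) x.1) }
      fin := inferInstance }
  refine ⟨BurnsideRing.of U, ?_⟩
  rw [iota_of]
  refine of_congr (FinGSet.Iso.of_bijective (X := (BifreeBiset.tilde U).toFinGSet)
    (Y := X.toFinGSet)
    (fun z : U.carrier × G => (((1 : G), z.2⁻¹) • z.1.1 : X.carrier)) ⟨?_, ?_⟩ ?_)
  · rintro ⟨x, g⟩ ⟨y, k⟩ hxy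
    have h1 := congrArg q hxy
    simp only [hq, x.2, y.2] at h1
    obtain rfl : g = k := by simpa using h1
    exact Prod.ext (Subtype.ext (MulAction.injective ((1 : G), g⁻¹) hxy)) rfl
  · intro x
    refine ⟨(⟨((1 : G), q x) • x, by rw [hq]; simp⟩, q x), ?_⟩
    change ((1 : G), (q x)⁻¹) • ((1 : G), q x) • x = x
    rw [← mul_smul, Prod.mk_mul_mk, one_mul, inv_mul_cancel]
    exact one_smul (G × G) x
  · rintro p ⟨x, g⟩
    change ((1 : G), (p.1 * g * p.2⁻¹)⁻¹) • (p.1, p.1) • x.1 = p • ((1 : G), g⁻¹) • x.1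
    rw [← mul_smul, ← mul_smul]
    congr 1
    exact Prod.ext (by simp) (by simp [mul_assoc])

/-- Write γ as a difference of bisets and split off from each the points whose stabilizers lie in a
conjugate of the diagonal; that part lies in the image of ι. The remainders have equal marks at
every subgroup not contained in such a conjugate. All their point stabilizers are of this kind, so
`FinGSet.iso_of_mark_eq` makes the remainders isomorphic, and they cancel. -/
theorem mem_range_iota {γ : BifreeRing G}
    (h : ∀ (L : Subgroup (G × G)),
      let a := (MonoidHom.fst G G).comp L.subtype
      let b := (MonoidHom.snd G G).comp L.subtype
      ¬ HomConj a b → bimarkHom a b γ = 0) : γ ∈ Set.range (iota G) := by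
  obtain ⟨A, B, rfl⟩ := BifreeRing.exists_sub γ
  have split : ∀ X : BifreeBiset G, ∃ Y : BifreeBiset G, (∀ y : Y.carrier, ¬ ConjPoint y) ∧
      ∃ x, BifreeRing.of X = iota G x + BifreeRing.of Y := fun X => by
    obtain ⟨x, hx⟩ := of_mem_range_iota (X := X.sub ConjPoint ConjPoint.smul) (by
      rintro ⟨x, g, hg⟩
      exact ⟨g, fun p hp => hg p (congrArg Subtype.val hp)⟩)
    refine ⟨X.sub (fun x => ¬ ConjPoint x) (FinGSet.not_smul ConjPoint.smul), ?_, x, ?_⟩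
    · rintro ⟨x, hx⟩ ⟨g, hg⟩
      exact hx ⟨g, fun p hp => hg p (Subtype.ext hp)⟩
    · rw [hx, ← bifree_of_add]
      refine (of_congr ?_).symm
      exact FinGSet.sub_sum_sub_not X.toFinGSet ConjPoint ConjPoint.smul
  obtain ⟨A', hA, x, hx⟩ := split A
  obtain ⟨B', hB, y, hy⟩ := split B
  have hmark : ∀ L : Subgroup (G × G), (¬ ∃ g : G, ∀ p ∈ L, p.1 = g * p.2 * g⁻¹) →
      A'.toFinGSet.mark L.subtype = B'.toFinGSet.mark L.subtype := fun L hL => by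
    have hn : ¬ HomConj ((MonoidHom.fst G G).comp L.subtype)
        ((MonoidHom.snd G G).comp L.subtype) := fun hc => by
      obtain ⟨g, hg⟩ := hc.symm
      exact hL ⟨g, fun p hp => hg ⟨p, hp⟩⟩
    have h1 := h L hn
    rw [hx, hy, map_sub, map_add, map_add, bimarkHom_iota, bimarkHom_iota,
      bimarkHom_one_of_not_homConj hn, bimarkHom_of, bimarkHom_of] at h1
    have h2 : (A'.bimark ((MonoidHom.fst G G).comp L.subtype)
        ((MonoidHom.snd G G).comp L.subtype) : ℤ) =
        B'.bimark ((MonoidHom.fst G G).comp L.subtype)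
        ((MonoidHom.snd G G).comp L.subtype) := by linarith
    exact_mod_cast h2
  have hAB : A'.Iso B' := FinGSet.iso_of_mark_eq
    (fun z => hmark _ fun ⟨g, hg⟩ => hA z ⟨g, hg⟩) (fun z => hmark _ fun ⟨g, hg⟩ => hB z ⟨g, hg⟩)
  refine ⟨x - y, ?_⟩
  rw [hx, hy, of_congr hAB, map_sub]
  abel

/-- The group homomorphism `B(G)ˣ → B^Δ_∘(G, G)` induced by `ι`. -/
def iotaUnits (G : Type u) [Group G] [Finite G] : (BurnsideRing G)ˣ →* orthogonalUnits G :=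
  ((iota G).toMonoidHom.comp (Units.coeHom _)).codRestrict (orthogonalUnits G) fun x =>
    (iota_mem_orthogonalUnits_iff _).2 x.isUnit

instance iotaUnits_range_normal : (iotaUnits G).range.Normal where
  conj_mem := by
    rintro _ ⟨x, rfl⟩ γ
    obtain ⟨y, hy⟩ := mem_range_iota (γ := (γ : BifreeRing G) * iota G x * star (γ : BifreeRing G))
      fun L h => bimarkHom_conj_iota_eq_zero γ x h
    have hy' : iota G y = ((γ * iotaUnits G x * γ⁻¹ : orthogonalUnits G) : BifreeRing G) := hy
    obtain ⟨u, rfl⟩ := (iota_mem_orthogonalUnits_iff y).1 (hy' ▸ SetLike.coe_mem _)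
    exact ⟨u, Subtype.ext hy'⟩

end IotaRange

/-! ## The embedding of `Out(G)` -/

section Outer

variable {G : Type u} [Group G] [Finite G]

theorem outBasis_coe (φ : MulAut G) :
    outBasis G (φ : Out G) = BifreeRing.of (BifreeBiset.twist φ) := of_autCoset φ

theorem eta_single_eq (o : Out G) : eta G (MonoidAlgebra.single o 1) = outBasis G o := by
  change MonoidAlgebra.lift ℤ (BifreeRing G) (Out G) (outBasis G) _ = _
  rw [MonoidAlgebra.lift_single, one_smul]

theorem twist_op (φ : MulAut G) :
    (BifreeBiset.twist φ).op.Iso (BifreeBiset.twist φ⁻¹) := by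
  refine FinGSet.Iso.of_bijective (X := (BifreeBiset.twist φ).op.toFinGSet)
    (Y := (BifreeBiset.twist φ⁻¹).toFinGSet) (fun (x : G) => (φ⁻¹ x⁻¹ : G))
    ((φ⁻¹ : MulAut G).bijective.comp (Equiv.inv G).bijective) fun p (x : G) => ?_
  change φ⁻¹ (p.2 * x * (φ p.1)⁻¹)⁻¹ = p.1 * φ⁻¹ x⁻¹ * (φ⁻¹ p.2)⁻¹
  simp [mul_assoc]

theorem star_outBasis (o : Out G) : star (outBasis G o) = outBasis G o⁻¹ := by
  induction o using QuotientGroup.induction_on with | H φ => ?_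
  rw [← QuotientGroup.mk_inv, outBasis_coe, outBasis_coe, star_of, of_congr (twist_op φ)]

/-- The group homomorphism `Out(G) → B^Δ_∘(G, G)` induced by `η`. -/
def etaUnits (G : Type u) [Group G] [Finite G] : Out G →* orthogonalUnits G :=
  (outBasis G).codRestrict (orthogonalUnits G) fun o => by
    rw [Unitary.mem_iff, star_outBasis, ← map_mul, ← map_mul, inv_mul_cancel, mul_inv_cancel,
      map_one, and_self]

/-- The biset `X × G` with `a (x, g) b = (φ⁻¹(a) x, a g φ(b))`. -/
def BifreeBiset.twistTilde (φ : MulAut G) (X : FinGSet G) : BifreeBiset G where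
  carrier := X.carrier × G
  act :=
    { smul := fun p z => (φ⁻¹ p.1 • z.1, p.1 * z.2 * (φ p.2)⁻¹)
      one_smul := fun z => Prod.ext (by
        change φ⁻¹ (1 : G) • z.1 = z.1
        simp) (by
        change 1 * z.2 * (φ 1)⁻¹ = z.2
        simp)
      mul_smul := fun p q z => Prod.ext (by
        change φ⁻¹ (p.1 * q.1) • z.1 = φ⁻¹ p.1 • φ⁻¹ q.1 • z.1
        rw [map_mul, mul_smul]) (by
        change (p.1 * q.1) * z.2 * (φ (p.2 * q.2))⁻¹ = p.1 * (q.1 * z.2 * (φ q.2)⁻¹) * (φ p.2)⁻¹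
        rw [map_mul]
        group) }
  fin := inferInstance
  left_free := fun g z h => by
    have h1 : g * z.2 * (φ 1)⁻¹ = z.2 := congrArg Prod.snd h
    simpa using h1
  right_free := fun g z h => by
    have h1 : 1 * z.2 * (φ g)⁻¹ = z.2 := congrArg Prod.snd h
    simpa using h1

theorem twist_tensor_tilde (φ : MulAut G) (X : FinGSet G) :
    ((BifreeBiset.twist φ).tensor (BifreeBiset.tilde X)).Iso
      (BifreeBiset.twistTilde φ X) := by
  refine BifreeBiset.tensor_iso (X := BifreeBiset.twist φ) (Y := BifreeBiset.tilde X)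
    (Z := BifreeBiset.twistTilde φ X)
    (fun (g : G) (z : X.carrier × G) => ((φ⁻¹ g • z.1, g * φ z.2) : X.carrier × G)) ?_ ?_ ?_ ?_
  · intro h (g : G) (z : X.carrier × G)
    change ((φ⁻¹ (1 * g * (φ h)⁻¹) • h • z.1, (1 * g * (φ h)⁻¹) * φ (h * z.2 * 1⁻¹)) :
      X.carrier × G) = (φ⁻¹ g • z.1, g * φ z.2)
    simp [← mul_smul]
  · intro (g : G) (z : X.carrier × G) (g' : G) (z' : X.carrier × G) h
    have h1 : φ⁻¹ g • z.1 = φ⁻¹ g' • z'.1 := congrArg (fun t => t.1) h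
    have h2 : g * φ z.2 = g' * φ z'.2 := congrArg (fun t => t.2) h
    refine ⟨φ⁻¹ (g'⁻¹ * g), ?_, Prod.ext ?_ ?_⟩
    · change g' = 1 * g * (φ (φ⁻¹ (g'⁻¹ * g)))⁻¹
      simp
    · change z'.1 = φ⁻¹ (g'⁻¹ * g) • z.1
      rw [map_mul, mul_smul, h1, map_inv, inv_smul_smul]
    · change z'.2 = φ⁻¹ (g'⁻¹ * g) * z.2 * 1⁻¹
      apply φ.injective
      simp [mul_assoc, h2]
  · rintro ⟨x, g⟩
    exact ⟨(1 : G), (x, φ⁻¹ g), Prod.ext (by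
      change φ⁻¹ (1 : G) • x = x
      simp) (by
      change 1 * φ (φ⁻¹ g) = g
      simp)⟩
  · intro a b (g : G) (z : X.carrier × G)
    change ((φ⁻¹ (a * g * (φ 1)⁻¹) • (1 : G) • z.1, (a * g * (φ 1)⁻¹) * φ (1 * z.2 * b⁻¹)) :
      X.carrier × G) = (φ⁻¹ a • φ⁻¹ g • z.1, a * (g * φ z.2) * (φ b)⁻¹)
    simp [← mul_smul, mul_assoc]

theorem tilde_tensor_twist (φ : MulAut G) (X : FinGSet G) :
    ((BifreeBiset.tilde (X.res (MulEquiv.toMonoidHom φ⁻¹))).tensor (BifreeBiset.twist φ)).Iso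
      (BifreeBiset.twistTilde φ X) := by
  refine BifreeBiset.tensor_iso (X := BifreeBiset.tilde (X.res (MulEquiv.toMonoidHom φ⁻¹)))
    (Y := BifreeBiset.twist φ) (Z := BifreeBiset.twistTilde φ X)
    (fun (z : X.carrier × G) (g : G) => ((z.1, z.2 * g) : X.carrier × G)) ?_ ?_ ?_ ?_
  · intro h (z : X.carrier × G) (g : G)
    change ((φ⁻¹ (1 : G) • z.1, (1 * z.2 * h⁻¹) * (h * g * (φ 1)⁻¹)) : X.carrier × G) =
      (z.1, z.2 * g)
    simp
  · intro (z : X.carrier × G) (g : G) (z' : X.carrier × G) (g' : G) h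
    have h1 : z.1 = z'.1 := congrArg (fun t => t.1) h
    have h2 : z.2 * g = z'.2 * g' := congrArg (fun t => t.2) h
    refine ⟨z'.2⁻¹ * z.2, Prod.ext ?_ ?_, ?_⟩
    · change z'.1 = φ⁻¹ (1 : G) • z.1
      simp [h1]
    · change z'.2 = 1 * z.2 * (z'.2⁻¹ * z.2)⁻¹
      group
    · change g' = (z'.2⁻¹ * z.2) * g * (φ 1)⁻¹
      simp [mul_assoc, h2]
  · rintro ⟨x, g⟩
    exact ⟨(x, g), (1 : G), Prod.ext rfl (mul_one g)⟩
  · intro a b (z : X.carrier × G) (g : G)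
    change ((φ⁻¹ a • z.1, (a * z.2 * 1⁻¹) * (1 * g * (φ b)⁻¹)) : X.carrier × G) =
      (φ⁻¹ a • z.1, a * (z.2 * g) * (φ b)⁻¹)
    simp [mul_assoc]

/-- For the class of a G-set X, both products are represented by the common model
`BifreeBiset.twistTilde`. -/
theorem outBasis_mul_iota (o : Out G) (x : BurnsideRing G) :
    outBasis G o * iota G x = iota G (outAct G o x) * outBasis G o := by
  induction o using QuotientGroup.induction_on with | H φ => ?_
  have key : ∀ X : FinGSet G, outBasis G (φ : Out G) * iota G (BurnsideRing.of X) =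
      iota G (outAct G (φ : Out G) (BurnsideRing.of X)) * outBasis G (φ : Out G) := fun X => by
    have h : outAct G (φ : Out G) (BurnsideRing.of X) =
        BurnsideRing.of (X.res (MulEquiv.toMonoidHom φ⁻¹)) := resHom_of _ X
    rw [h, outBasis_coe, iota_of, iota_of, ← of_tensor, ← of_tensor,
      of_congr (twist_tensor_tilde φ X), of_congr (tilde_tensor_twist φ X)]
  obtain ⟨X, Y, rfl⟩ := BurnsideRing.exists_sub x
  simp only [map_sub, mul_sub, sub_mul, key]

theorem etaUnits_conj_iotaUnits (o : Out G) (x : (BurnsideRing G)ˣ) :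
    etaUnits G o * iotaUnits G x * (etaUnits G o)⁻¹ =
      iotaUnits G (Units.map (outAct G o).toMonoidHom x) := by
  rw [mul_inv_eq_iff_eq_mul]
  exact Subtype.ext (outBasis_mul_iota o x)

end Outer

/-! ## The map `ρ` on orthogonal units -/

section OuterClasses

variable {G : Type u} [Group G]

/-- An automorphism of `G` as a homomorphism. -/
abbrev autHom (φ : MulAut G) : G →* G := MulEquiv.toMonoidHom φ

/-- This links Out(G) to conjugacy of homomorphisms. Moving an inner automorphism past φ replaces
its element g by φ(g), which accounts for the witnesses. -/
theorem out_eq_iff {φ ψ : MulAut G} :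
    (φ : Out G) = (ψ : Out G) ↔ HomConj (autHom φ) (autHom ψ) := by
  rw [QuotientGroup.eq]
  constructor
  · rintro ⟨g, hg⟩
    refine ⟨φ g, fun k => ?_⟩
    have h := congrArg φ (DFunLike.congr_fun hg k)
    simpa using h.symm
  · rintro ⟨g, hg⟩
    refine ⟨φ⁻¹ g, ?_⟩
    ext k
    have h : ψ k = g * φ k * g⁻¹ := hg k
    apply φ.injective
    simp [h]

theorem single_unit_inj {o o' : Out G} {ε ε' : ℤˣ}
    (h : MonoidAlgebra.single o (ε : ℤ) = MonoidAlgebra.single o' (ε' : ℤ)) :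
    o = o' ∧ ε = ε' := by
  rcases MonoidAlgebra.single_inj.1 h with h | h
  · exact ⟨h.1, Units.ext h.2⟩
  · exact absurd h.1 ε.ne_zero

theorem centCard_autHom (φ : MulAut G) : centCard (autHom φ) = centCard (MonoidHom.id G) := by
  have h1 : (autHom φ).range = ⊤ := MonoidHom.range_eq_top.2 φ.surjective
  have h2 : (MonoidHom.id G).range = ⊤ := MonoidHom.range_eq_top.2 Function.surjective_id
  rw [centCard, centCard, h1, h2]

/-- A stabilizer containing the graph of φ cannot be larger, since left freeness allows only one
first component for each second component. -/
theorem stabilizer_eq_autDiagonal_iff {X : BifreeBiset G} {x : X.carrier} {φ : MulAut G} :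
    MulAction.stabilizer (G × G) x = autDiagonal φ ↔ ∀ k : G, (φ k, k) • x = x := by
  constructor
  · intro h k
    exact MulAction.mem_stabilizer_iff.1 (h.symm ▸ mem_autDiagonal.2 rfl)
  · intro h
    ext ⟨a, b⟩
    rw [mem_autDiagonal, MulAction.mem_stabilizer_iff]
    refine ⟨fun hx => ?_, fun hab => ?_⟩
    · have h1 := hx.trans (h b).symm
      rw [← inv_smul_eq_iff, ← mul_smul] at h1
      exact (inv_mul_eq_one.1 (X.left_free ((φ b)⁻¹ * a) x (by simpa using h1))).symm
    · obtain rfl : a = φ b := hab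
      exact h b

/-- The counted points lie in the orbits of the outer class of φ, and in each of these orbits the
centralizer of the image of φ acts simply transitively on them. -/
theorem bimark_autHom (X : BifreeBiset G) (φ : MulAut G) :
    X.bimark (autHom φ) (MonoidHom.id G) =
      (outOrbits X (φ : Out G)).ncard * centCard (autHom φ) := by
  let Z := Subgroup.centralizer ((autHom φ).range : Set G)
  have hZ : ∀ g : G, g ∈ Z ↔ ∀ k, φ k * g = g * φ k := fun g =>
    Subgroup.mem_centralizer_iff.trans Set.forall_mem_range
  have hs : ∀ O : outOrbits X (φ : Out G), ∃ x : X.carrier,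
      O.1 = MulAction.orbit (G × G) x ∧ ∀ k, (φ k, k) • x = x := by
    rintro ⟨_, x, rfl, ψ, hψ, hx⟩
    obtain ⟨g, hg⟩ := out_eq_iff.1 hψ
    -- The orbit comes with a point whose stabilizer is the graph of some ψ in the class of φ; left
    -- translation by the conjugating element turns it into a point fixed by the graph of φ.
    refine ⟨(g, (1 : G)) • x, ?_, fun k => ?_⟩
    · exact (MulAction.orbit_smul (g, (1 : G)) x).symm
    · have h1 : (φ k, k) * (g, (1 : G)) = (g, (1 : G)) * (ψ k, k) := by
        have h2 : φ k = g * ψ k * g⁻¹ := hg k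
        refine Prod.ext ?_ (by simp)
        change φ k * g = g * ψ k
        rw [h2]
        group
      rw [← mul_smul, h1, mul_smul, stabilizer_eq_autDiagonal_iff.1 hx k]
  choose s hsO hsx using hs
  have hmem : ∀ q : outOrbits X (φ : Out G) × Z, ∀ k : G,
      ((autHom φ).prod (MonoidHom.id G)) k • ((q.2 : G), (1 : G)) • s q.1 =
        ((q.2 : G), (1 : G)) • s q.1 := fun q k => by
    have h1 : (φ k, k) * ((q.2 : G), (1 : G)) = ((q.2 : G), (1 : G)) * (φ k, k) :=
      Prod.ext ((hZ _).1 q.2.2 k) (by simp)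
    change (φ k, k) • ((q.2 : G), (1 : G)) • s q.1 = _
    rw [← mul_smul, h1, mul_smul, hsx]
  rw [centCard, ← Nat.card_coe_set_eq, ← Nat.card_prod]
  refine (Nat.card_congr (Equiv.ofBijective
    (β := {x : X.carrier // ∀ k : G, ((autHom φ).prod (MonoidHom.id G)) k • x = x})
    (fun q => ⟨((q.2 : G), (1 : G)) • s q.1, hmem q⟩) ⟨?_, ?_⟩)).symm
  · rintro ⟨O, z⟩ ⟨O', z'⟩ h
    have h1 : ((z : G), (1 : G)) • s O = ((z' : G), (1 : G)) • s O' := congrArg Subtype.val h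
    obtain rfl : O = O' := Subtype.ext (by
      rw [hsO, hsO, ← MulAction.orbit_smul ((z : G), (1 : G)) (s O), h1, MulAction.orbit_smul])
    rw [← inv_smul_eq_iff, ← mul_smul] at h1
    have := X.left_free ((z' : G)⁻¹ * z) _ (by simpa using h1)
    exact Prod.ext rfl (Subtype.ext (inv_mul_eq_one.1 this).symm)
  · rintro ⟨x, hx⟩
    have hx' : ∀ k, (φ k, k) • x = x := hx
    let O : outOrbits X (φ : Out G) :=
      ⟨_, x, rfl, φ, rfl, stabilizer_eq_autDiagonal_iff.2 hx'⟩
    obtain ⟨⟨a, b⟩, hab⟩ : x ∈ MulAction.orbit (G × G) (s O) :=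
      hsO O ▸ MulAction.mem_orbit_self x
    have hab' : (a, b) • s O = x := hab
    -- As (φ b, b) fixes the base point, the right translation can be traded for a left one.
    have hz : (a * (φ b)⁻¹, (1 : G)) • s O = x := by
      rw [← hab', ← hsx O b, ← mul_smul, hsx O b]
      simp
    refine ⟨(O, ⟨a * (φ b)⁻¹, (hZ _).2 fun k => ?_⟩), Subtype.ext hz⟩
    -- Both x and the base point are fixed by (φ k, k), so left freeness forces the left translation
    -- to commute with φ k.
    have h2 := hx' k
    rw [← hz, ← mul_smul, ← inv_smul_eq_iff, ← mul_smul] at h2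
    nth_rewrite 2 [← hsx O k] at h2
    rw [← inv_smul_eq_iff, ← mul_smul] at h2
    generalize a * (φ b)⁻¹ = c at h2 ⊢
    have := X.left_free ((φ k)⁻¹ * (c⁻¹ * (φ k * c))) _ (by simpa [mul_assoc] using h2)
    rw [inv_mul_eq_one, eq_comm, inv_mul_eq_iff_eq_mul] at this
    exact this

end OuterClasses

theorem isComplement'_ker_range {A B : Type*} [Group A] [Group B] {p : A →* B} {s : B →* A}
    (h : ∀ b, p (s b) = b) : Subgroup.IsComplement' p.ker s.range := by
  refine Subgroup.isComplement'_of_disjoint_and_mul_eq_univ (Subgroup.disjoint_def.2 ?_)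
    (Set.eq_univ_of_forall fun a => ?_)
  · rintro _ ha ⟨b, rfl⟩
    rw [MonoidHom.mem_ker, h] at ha
    rw [ha, map_one]
  · refine Set.mem_mul.2 ⟨a * (s (p a))⁻¹, ?_, s (p a), ⟨_, rfl⟩, by group⟩
    rw [SetLike.mem_coe, MonoidHom.mem_ker, map_mul, map_inv, h, mul_inv_cancel]

/-! ### The sign and the outer automorphism of an orthogonal unit. -/

section Rho

variable {G : Type u} [Group G] [Finite G]

theorem coeff_rho_of (X : BifreeBiset G) (o : Out G) :
    (rho G (BifreeRing.of X)).coeff o = (outOrbits X o).ncard := by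
  classical
  let _ := Fintype.ofFinite (Out G)
  rw [rho_of, finsum_eq_sum_of_fintype, MonoidAlgebra.coeff_sum, Finsupp.finsetSum_apply]
  simp [Finsupp.single_apply]

theorem bimarkHom_autHom (γ : BifreeRing G) (φ : MulAut G) :
    bimarkHom (autHom φ) (MonoidHom.id G) γ =
      (rho G γ).coeff (φ : Out G) * centCard (MonoidHom.id G) := by
  obtain ⟨X, Y, rfl⟩ := BifreeRing.exists_sub γ
  simp only [map_sub, MonoidAlgebra.coeff_sub, Finsupp.sub_apply, coeff_rho_of, bimarkHom_of,
    bimark_autHom, centCard_autHom]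
  push_cast
  ring

theorem bimarkHom_autHom_ne_zero_iff (γ : BifreeRing G) (φ : MulAut G) :
    bimarkHom (autHom φ) (MonoidHom.id G) γ ≠ 0 ↔ (rho G γ).coeff (φ : Out G) ≠ 0 := by
  rw [bimarkHom_autHom, mul_ne_zero_iff, and_iff_left]
  exact_mod_cast (centCard_pos _).ne'

/-- If x is fixed through (a, id) and a k = 1, then x k = x, so k = 1 by right freeness. Thus a is
injective, and bijective as G is finite. When γ is a difference of bisets, at least one of the two
has such a point. -/
theorem exists_autHom_eq {γ : BifreeRing G} {a : G →* G}
    (h : bimarkHom a (MonoidHom.id G) γ ≠ 0) : ∃ φ : MulAut G, autHom φ = a := by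
  have key : ∀ X : BifreeBiset G, X.bimark a (MonoidHom.id G) ≠ 0 → Function.Injective a := by
    intro X hX
    obtain ⟨⟨x, hx⟩⟩ := (Nat.card_pos_iff.1 (Nat.pos_of_ne_zero hX)).1
    refine (injective_iff_map_eq_one a).2 fun k hk => X.right_free k x ?_
    have h1 : (a k, k) • x = x := hx k
    rwa [hk] at h1
  have hinj : Function.Injective a := by
    obtain ⟨X, Y, rfl⟩ := BifreeRing.exists_sub γ
    by_cases hX : X.bimark a (MonoidHom.id G) = 0
    · refine key Y fun hY => h ?_
      rw [map_sub, bimarkHom_of, bimarkHom_of, hX, hY, sub_self]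
    · exact key X hX
  exact ⟨MulEquiv.ofBijective a (Finite.injective_iff_bijective.1 hinj), rfl⟩

/-- The column of γ at the identity is supported on one conjugacy class, necessarily of an
automorphism φ. The mark there has square |Z(G)|², so the coefficient of ρ(γ) at φ is ±1, and all
other coefficients vanish. -/
theorem exists_rho_eq_single (γ : orthogonalUnits G) :
    ∃ p : Out G × ℤˣ, rho G (γ : BifreeRing G) = MonoidAlgebra.single p.1 (p.2 : ℤ) := by
  -- A nonzero entry in the column of γ at the identity is a nonzero entry in the corresponding row
  -- of its transpose.
  obtain ⟨a, ha⟩ := exists_bimarkHom_ne_zero (star γ) (MonoidHom.id G)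
  rw [bimarkHom_star_coe] at ha
  obtain ⟨φ, rfl⟩ := exists_autHom_eq ha
  have h1 := bimarkHom_sq_eq γ ha
  have hc : (centCard (MonoidHom.id G) : ℤ) ≠ 0 := by exact_mod_cast (centCard_pos _).ne'
  rw [bimarkHom_autHom, centCard_autHom, mul_pow, ← sq] at h1
  have h2 : (rho G (γ : BifreeRing G)).coeff (φ : Out G) ^ 2 = 1 :=
    mul_right_cancel₀ (pow_ne_zero 2 hc) (h1.trans (one_mul _).symm)
  obtain ⟨ε, hε⟩ := IsUnit.of_pow_eq_one h2 two_ne_zero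
  refine ⟨((φ : Out G), ε), ?_⟩
  ext o
  rw [MonoidAlgebra.coeff_single]
  by_cases ho : (φ : Out G) = o
  · subst ho
    rw [Finsupp.single_eq_same, hε]
  · rw [Finsupp.single_eq_of_ne (Ne.symm ho)]
    by_contra h
    induction o using QuotientGroup.induction_on with | H ψ => ?_
    exact ho (out_eq_iff.2 (homConj_of_bimarkHom_ne_zero_left γ ha
      ((bimarkHom_autHom_ne_zero_iff _ ψ).2 h)))

/-- The outer automorphism underlying an orthogonal unit. -/
def outOf (γ : orthogonalUnits G) : Out G := (exists_rho_eq_single γ).choose.1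

theorem outOf_eq_iff (γ : orthogonalUnits G) (o : Out G) : outOf γ = o ↔
    ∃ ε : ℤˣ, rho G (γ : BifreeRing G) = MonoidAlgebra.single o (ε : ℤ) := by
  have h := (exists_rho_eq_single γ).choose_spec
  constructor
  · rintro rfl
    exact ⟨_, h⟩
  · rintro ⟨ε, hε⟩
    exact (single_unit_inj (h.symm.trans hε)).1

theorem outOf_eq_coe_iff (γ : orthogonalUnits G) (φ : MulAut G) : outOf γ = (φ : Out G) ↔
    bimarkHom (autHom φ) (MonoidHom.id G) (γ : BifreeRing G) ≠ 0 := by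
  rw [bimarkHom_autHom_ne_zero_iff]
  obtain ⟨ε, hε⟩ := (outOf_eq_iff γ _).1 rfl
  rw [hε, MonoidAlgebra.coeff_single]
  refine ⟨fun h => by rw [h, Finsupp.single_eq_same]; exact ε.ne_zero, fun h => ?_⟩
  by_contra h'
  exact h (Finsupp.single_eq_of_ne (Ne.symm h'))

/-- The fixed points depend only on the image of K in G × G. With f an automorphism ψ of G, this
identifies the mark at (φψ, ψ) with the one at (φ, id). -/
theorem bimarkHom_comp {K K' : Type u} [Group K] [Group K'] (a b : K →* G) {f : K' →* K}
    (hf : Function.Surjective f) (γ : BifreeRing G) :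
    bimarkHom (a.comp f) (b.comp f) γ = bimarkHom a b γ := by
  obtain ⟨X, Y, rfl⟩ := BifreeRing.exists_sub γ
  have h : ∀ X : BifreeBiset G, X.bimark (a.comp f) (b.comp f) = X.bimark a b := fun X =>
    Nat.card_congr (Equiv.subtypeEquivRight fun x =>
      (hf.forall (p := fun k => (a.prod b) k • x = x)).symm)
  simp only [map_sub, bimarkHom_of, h]

/-- In the product formula for the mark of γδ at (φψ, id), only b conjugate to ψ contributes, and
all these terms equal the same nonzero product of marks at (φ, id) and (ψ, id). Hence nothing
cancels. -/
theorem outOf_mul (γ δ : orthogonalUnits G) : outOf (γ * δ) = outOf γ * outOf δ := by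
  classical
  let _ := Fintype.ofFinite (G →* G)
  obtain ⟨φ, hφ⟩ := QuotientGroup.mk_surjective (outOf γ)
  obtain ⟨ψ, hψ⟩ := QuotientGroup.mk_surjective (outOf δ)
  rw [← hφ, ← hψ, ← QuotientGroup.mk_mul, outOf_eq_coe_iff]
  have h1 := (outOf_eq_coe_iff γ φ).1 hφ.symm
  have h2 := (outOf_eq_coe_iff δ ψ).1 hψ.symm
  have h3 := card_mul_bimarkHom_mul (autHom (φ * ψ)) (MonoidHom.id G)
    (γ : BifreeRing G) (δ : BifreeRing G)
  have h4 : ∀ b : G →* G, bimarkHom (autHom (φ * ψ)) b (γ : BifreeRing G) *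
      bimarkHom b (MonoidHom.id G) (δ : BifreeRing G) = if HomConj (autHom ψ) b then
        bimarkHom (autHom φ) (MonoidHom.id G) (γ : BifreeRing G) *
          bimarkHom (autHom ψ) (MonoidHom.id G) (δ : BifreeRing G) else 0 := fun b => by
    split_ifs with hb
    · rw [← bimarkHom_conj (HomConj.refl _) hb, ← bimarkHom_conj hb (HomConj.refl _)]
      congr 1
      exact bimarkHom_comp (autHom φ) (MonoidHom.id G) (f := autHom ψ) ψ.surjective _
    · refine mul_eq_zero_of_right _ (not_not.1 fun h => hb ?_)
      exact homConj_of_bimarkHom_ne_zero_left δ h2 h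
  rw [Finset.sum_congr rfl fun b _ => h4 b, ← Finset.sum_filter, Finset.sum_const] at h3
  intro h
  replace h : bimarkHom (autHom (φ * ψ)) (MonoidHom.id G)
    ((γ : BifreeRing G) * (δ : BifreeRing G)) = 0 := h
  rw [h, mul_zero, eq_comm, nsmul_eq_mul, mul_eq_zero] at h3
  refine h3.elim (fun h3 => ?_) (mul_ne_zero h1 h2)
  rw [Nat.cast_eq_zero, Finset.card_eq_zero] at h3
  exact Finset.eq_empty_iff_forall_notMem.1 h3 (autHom ψ) 
    (Finset.mem_filter.2 ⟨Finset.mem_univ _, HomConj.refl _⟩)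

/-- The group homomorphism `B^Δ_∘(G, G) → Out(G)`. -/
def piHom (G : Type u) [Group G] [Finite G] : orthogonalUnits G →* Out G :=
  MonoidHom.mk' outOf outOf_mul

theorem piHom_etaUnits (o : Out G) : piHom G (etaUnits G o) = o := by
  refine (outOf_eq_iff _ o).2 ⟨1, ?_⟩
  induction o using QuotientGroup.induction_on with | H φ => ?_
  exact rho_autCoset φ

/-- The mark of ι(x) at (id, id) is a mark of the unit x times |Z(G)|, hence nonzero. -/
theorem piHom_iotaUnits (x : (BurnsideRing G)ˣ) : piHom G (iotaUnits G x) = 1 := by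
  refine (outOf_eq_coe_iff (iotaUnits G x) 1).2 ?_
  have h : bimarkHom (MonoidHom.id G) (MonoidHom.id G) (iota G x) ≠ 0 := by
    rw [bimarkHom_iota, bimarkHom_one_self]
    exact mul_ne_zero (x.isUnit.map (markHom _)).ne_zero
      (by exact_mod_cast (centCard_pos _).ne')
  exact h

end Rho

end BurnsideUnits

end

/-! ### The theorem. -/

open BurnsideUnits
theorem lemma3p2 {G : Type u} [Group G] [Finite G] :
    -- (a), the equality of sets
    iota G '' {x : BurnsideRing G | IsUnit x} =
      Set.range (iota G) ∩ (orthogonalUnits G : Set (BifreeRing G)) ∧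
    -- the restrictions of `ι` and `η`, and the map `π`; each of them is pinned down below
    ∃ (ι : (BurnsideRing G)ˣ →* orthogonalUnits G) (η : Out G →* orthogonalUnits G)
      (π : orthogonalUnits G →* Out G),
      -- (a), normality
      (∀ x : (BurnsideRing G)ˣ, (ι x : BifreeRing G) = iota G x) ∧
      ι.range.Normal ∧
      -- (b)
      (∀ o : Out G, (η o : BifreeRing G) = eta G (MonoidAlgebra.single o 1)) ∧
      Function.Injective η ∧
      -- (c)
      (∀ γ : orthogonalUnits G, ∃! p : Out G × ℤˣ,
        rho G (γ : BifreeRing G) = MonoidAlgebra.single p.1 (p.2 : ℤ)) ∧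
      (∀ (γ : orthogonalUnits G) (o : Out G), π γ = o ↔
        ∃ ε : ℤˣ, rho G (γ : BifreeRing G) = MonoidAlgebra.single o (ε : ℤ)) ∧
      Function.Surjective π ∧
      π.comp η = MonoidHom.id (Out G) ∧
      -- (d)
      ι.range ≤ π.ker ∧
      π.ker.Normal ∧
      Subgroup.IsComplement' π.ker η.range ∧
      -- (e)
      ∀ (o : Out G) (x : (BurnsideRing G)ˣ),
        η o * ι x * (η o)⁻¹ = ι (Units.map (outAct G o).toMonoidHom x) := by
  -- Injectivity of η, surjectivity of π and the semidirect decomposition all come from the single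
  -- fact that η is a section of π.
  refine ⟨?_, iotaUnits G, etaUnits G, piHom G, fun _ => rfl, inferInstance,
    fun o => (eta_single_eq o).symm, Function.LeftInverse.injective piHom_etaUnits,
    fun γ => ?_, outOf_eq_iff, fun o => ⟨_, piHom_etaUnits o⟩, MonoidHom.ext piHom_etaUnits, ?_,
    inferInstance, isComplement'_ker_range piHom_etaUnits, etaUnits_conj_iotaUnits⟩
  · ext γ
    constructor
    · rintro ⟨x, hx, rfl⟩
      exact ⟨⟨x, rfl⟩, (iota_mem_orthogonalUnits_iff x).2 hx⟩
    · rintro ⟨⟨x, rfl⟩, hx⟩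
      exact ⟨x, (iota_mem_orthogonalUnits_iff x).1 hx, rfl⟩
  · obtain ⟨p, hp⟩ := exists_rho_eq_single γ
    refine ⟨p, hp, fun q hq => ?_⟩
    obtain ⟨h1, h2⟩ := single_unit_inj (hq.symm.trans hp)
    exact Prod.ext h1 h2
  · rintro _ ⟨x, rfl⟩
    exact piHom_iotaUnits x
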